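/- Let $k\ge 2$ be an integer. Let $Th_k^{k+1}$ be the $(k+1)$-ary Boolean operation that equals $1$ iff at least $k$ of its arguments equal $1$. Let $S_{10}^k$ be the functional clone generated by $Th_k^{k+1}$ if $k\ge 3$, and by $Th_2^3=\mathrm{maj}$ and $x\wedge(y\vee z)$ if $k=2$; let $S_{12}^k$ be the clone generated by $Th_k^{k+1}$ and $x\wedge(y\to z)$. For a set $\mathcal F$ of Boolean operations and a set $\mathcal S\subseteq\{0,1\}^n$, let $Cl_{\mathcal F}(\mathcal S)$ be the smallest set of vectors that contains $\mathcal S$ and is closed under the operations of $\mathcal F$ applied coordinatewise. Vectors are ordered by inclusion of their supports. An enumeration problem is a function $A:\Sigma^*\to\mathcal P(\Sigma^*)$ ($\Sigma$ a finite alphabet). It is in $\mathsf{DelayP}$ if some random access machine (with addition, subtraction, multiplication and an output instruction, logarithmic cost), on every input $w$, outputs each element of $A(w)$ exactly once and nothing else and then halts, the time before the first output, between consecutive outputs, and after the last output being bounded by a polynomial in $|w|$. A polynomial delay reduction from $A$ to $B$ consists of a polynomial-time computable $f:\Sigma^*\to\Sigma^*$ and a problem $C\in\mathsf{DelayP}$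 such that for every $x$: $C(xy)\cap C(xz)=\emptyset$ for all distinct $y,z\in B(f(x))$, and $A(x)=\bigcup_{y\in B(f(x))}C(xy)$. Two problems are equivalent if each has a polynomial delay reduction to the other. $\textsc{EnumClosureMax}_{S_{10}^k}$ is the problem of enumerating, given a finite set $\mathcal S$ of Boolean vectors of the same size, the maximal elements of $Cl_{S_{10}^k}(\mathcal S)\setminus\{\mathbf 0,\mathbf 1\}$. $\textsc{EnumKMaxIndSet}$ is the problem of enumerating, given a finite hypergraph all of whose hyperedges have at most $k$ elements, its inclusion-maximal independent sets (sets of vertices that contain no hyperedge). Sets of vectors and hypergraphs are given by the vector size (number of vertices) in unary and the list of the vectors (of the characteristic vectors of the hyperedges); solutions are written as characteristic vectors; words that encode no instance have no solutions. **Theorem.** 1. For every $n$ and every $\mathcal S\subseteq\{0,1\}^n$, the maximal elements of $Cl_{S_{10}^k}(\mathcal S)$ and of $Cl_{S_{12}^k}(\mathcal S)$ coincide. 2. $\textsc{EnumClosureMax}_{S_{10}^k}$ and $\textsc{EnumKMaxIndSet}$ are equivalent. -/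

import Mathlib

/-! ## Enumeration problems and their complexity

Words are over a fixed three-letter alphabet: `0` and `1` are bits, `2` is a separator. -/

namespace EnumComplexity

abbrev Letter : Type := Fin 3

abbrev Word : Type := List Letter

/-- An enumeration problem associates a set of words (its solutions) to each input word. -/
abbrev EnumProblem : Type := Word → Set Word

/-- Instructions of a random access machine. The machine has work registers `R 0, R 1, …`
holding natural numbers, read-only input registers holding the letters of the input word, and
output registers, each holding a letter. -/
inductive Instr : Type
  /-- `R d := c` -/
  | const (d c : ℕ)
  /-- `R d := R a + R b` -/
  | add (d a b : ℕ)
  /-- `R d := R a - R b` (truncated at zero) -/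
  | sub (d a b : ℕ)
  /-- `R d := R a * R b` -/
  | mul (d a b : ℕ)
  /-- `R d := R (R a)` -/
  | load (d a : ℕ)
  /-- `R (R a) := R b` -/
  | store (a b : ℕ)
  /-- `R d :=` length of the input word -/
  | inputLength (d : ℕ)
  /-- `R d :=` the letter of the input word at position `R a` (positions start at zero; the value
  is zero past the end of the word) -/
  | read (d a : ℕ)
  /-- set the output register number `R a` to the letter `R b` (modulo three) -/
  | write (a b : ℕ)
  /-- output the word stored in the first `R a` output registers -/
  | output (a : ℕ)
  /-- continue with the instruction number `l` -/
  | jump (l : ℕ)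
  /-- continue with the instruction number `l` if `R a = 0` -/
  | jumpIfZero (a l : ℕ)

/-- A program is a list of instructions, numbered from zero. -/
abbrev Program : Type := List Instr

/-- A configuration of the machine, together with the time elapsed since the start and the list
of all words that were output so far, in chronological order, each with the time at which its
production was completed. -/
structure Config : Type where
  pc : ℕ
  reg : ℕ → ℕ
  out : ℕ → Letter
  clock : ℕ
  produced : List (ℕ × Word)

def Config.start : Config where
  pc := 0
  reg := fun _ => 0
  out := fun _ => 0
  clock := 0
  produced := []

/-- The logarithmic cost of an instruction: one plus the number of bits of the numbers that it
handles (for `output`, also the length of the word that is output). -/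
def Instr.cost (w : Word) (R : ℕ → ℕ) : Instr → ℕ
  | .const _ c => 1 + c.size
  | .add _ a b => 1 + (R a).size + (R b).size
  | .sub _ a b => 1 + (R a).size + (R b).size
  | .mul _ a b => 1 + (R a).size + (R b).size
  | .load _ a => 1 + (R a).size + (R (R a)).size
  | .store a b => 1 + (R a).size + (R b).size
  | .inputLength _ => 1 + w.length.size
  | .read _ a => 1 + (R a).size
  | .write a b => 1 + (R a).size + (R b).size
  | .output a => 1 + (R a).size + R a
  | .jump _ => 1
  | .jumpIfZero a _ => 1 + (R a).size

/-- The configuration reached from `c` by executing one instruction on the input word `w`. -/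
def Instr.exec (w : Word) (c : Config) (i : Instr) : Config :=
  let t := c.clock + i.cost w c.reg
  let R := c.reg
  let next : Config := { c with pc := c.pc + 1, clock := t }
  match i with
  | .const d x => { next with reg := Function.update R d x }
  | .add d a b => { next with reg := Function.update R d (R a + R b) }
  | .sub d a b => { next with reg := Function.update R d (R a - R b) }
  | .mul d a b => { next with reg := Function.update R d (R a * R b) }
  | .load d a => { next with reg := Function.update R d (R (R a)) }
  | .store a b => { next with reg := Function.update R (R a) (R b) }
  | .inputLength d => { next with reg := Function.update R d w.length }
  | .read d a => { next with reg := Function.update R d (w.getD (R a) 0).val }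
  | .write a b => { next with out := Function.update c.out (R a) (Fin.ofNat 3 (R b)) }
  | .output a =>
      { next with produced := c.produced ++ [(t, (List.range (R a)).map c.out)] }
  | .jump l => { next with pc := l }
  | .jumpIfZero a l => { next with pc := if R a = 0 then l else c.pc + 1 }

/-- One step of the program `P` on the input word `w`; nothing happens once the program counter
has left the program. -/
def Program.step (P : Program) (w : Word) (c : Config) : Config :=
  match P[c.pc]? with
  | none => c
  | some i => i.exec w c

/-- The run of `P` on the input word `w` halts in the configuration `c`. -/
def Program.HaltsIn (P : Program) (w : Word) (c : Config) : Prop :=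
  P.length ≤ c.pc ∧ ∃ t : ℕ, (P.step w)^[t] Config.start = c

/-- `f` is computable in polynomial time: some program, on every input word `w`, outputs the
word `f w` and nothing else, and halts in time polynomial in the length of `w`. -/
def PolyTime (f : Word → Word) : Prop :=
  ∃ (P : Program) (p : Polynomial ℕ), ∀ w : Word, ∃ c : Config,
    P.HaltsIn w c ∧ c.clock ≤ p.eval w.length ∧ c.produced.map Prod.snd = [f w]

/-- The class of the enumeration problems that can be solved with polynomial delay: some program,
on every input word `w`, outputs every element of `A w` exactly once and nothing else and then
halts, and the time before the first output, between two consecutive outputs, and between the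
last output and the halt is bounded by a polynomial in the length of `w`. -/
def DelayP (A : EnumProblem) : Prop :=
  ∃ (P : Program) (p : Polynomial ℕ), ∀ w : Word, ∃ c : Config,
    P.HaltsIn w c ∧
    (c.produced.map Prod.snd).Nodup ∧
    {y | y ∈ c.produced.map Prod.snd} = A w ∧
    List.IsChain (fun s t => t ≤ s + p.eval w.length)
      (0 :: (c.produced.map Prod.fst ++ [c.clock]))

/-- There is a polynomial delay reduction from `A` to `B`. -/
def PolyDelayReducible (A B : EnumProblem) : Prop :=
  ∃ (f : Word → Word) (C : EnumProblem), PolyTime f ∧ DelayP C ∧ ∀ x : Word,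
    (∀ y ∈ B (f x), ∀ z ∈ B (f x), y ≠ z → C (x ++ y) ∩ C (x ++ z) = ∅) ∧
    A x = ⋃ y ∈ B (f x), C (x ++ y)

/-- `A` and `B` are equivalent: each reduces to the other. -/
def Equivalent (A B : EnumProblem) : Prop :=
  PolyDelayReducible A B ∧ PolyDelayReducible B A

end EnumComplexity

/-! ## Closures of sets of vectors, clones, and the two enumeration problems -/

namespace SetClosure

open EnumComplexity

/-- Operations of finite arity over `D`. -/
abbrev Op (D : Type) : Type := Σ t : ℕ, ((Fin t → D) → D)

/-- Membership in the closure of the set `S` of vectors of size `n` by the set `F` of operations,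
which act coefficient-wise. -/
inductive InCl {D : Type} (F : Set (Op D)) {n : ℕ} (S : Set (Fin n → D)) : (Fin n → D) → Prop
  | base (v : Fin n → D) (hv : v ∈ S) : InCl F S v
  | app (t : ℕ) (f : (Fin t → D) → D) (hf : (⟨t, f⟩ : Op D) ∈ F) (v : Fin t → Fin n → D)
      (hv : ∀ j, InCl F S (v j)) : InCl F S (fun i => f (fun j => v j i))

def Cl {D : Type} (F : Set (Op D)) {n : ℕ} (S : Set (Fin n → D)) : Set (Fin n → D) :=
  {v | InCl F S v}

/-- Membership in the functional clone generated by `F`. -/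
inductive InClone {D : Type} (F : Set (Op D)) : Op D → Prop
  | base (f : Op D) (hf : f ∈ F) : InClone F f
  | proj (t : ℕ) (i : Fin t) : InClone F ⟨t, fun x => x i⟩
  | comp (s t : ℕ) (f : (Fin s → D) → D) (g : Fin s → (Fin t → D) → D)
      (hf : InClone F ⟨s, f⟩) (hg : ∀ j, InClone F ⟨t, g j⟩) :
      InClone F ⟨t, fun x => f (fun j => g j x)⟩

def clone {D : Type} (F : Set (Op D)) : Set (Op D) := {f | InClone F f}

/-- The threshold function of arity `k + 1`, equal to one if and only if at least `k` of its
arguments are equal to one. For `k = 2` it is the majority function. -/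
def threshold (k : ℕ) : Op Bool :=
  ⟨k + 1, fun x => decide (k ≤ (Finset.univ.filter (fun i => x i = true)).card)⟩

/-- The operation `x ∧ (y ∨ z)`. -/
def andOr : Op Bool := ⟨3, fun x => x 0 && (x 1 || x 2)⟩

/-- The operation `x ∧ (y → z)`. -/
def andImp : Op Bool := ⟨3, fun x => x 0 && (!(x 1) || x 2)⟩

/-- The clone `S_10^k` for `k ≥ 2`: it is generated by majority and `x ∧ (y ∨ z)` if `k = 2`, and
by the threshold function alone if `k ≥ 3`. -/
def S10 (k : ℕ) : Set (Op Bool) :=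
  clone (if k = 2 then {threshold k, andOr} else {threshold k})

/-- The clone `S_12^k` for `k ≥ 2`. -/
def S12 (k : ℕ) : Set (Op Bool) := clone {threshold k, andImp}

/-- The maximal elements of a set of boolean vectors, ordered by inclusion of their supports. -/
def maxElements {n : ℕ} (T : Set (Fin n → Bool)) : Set (Fin n → Bool) :=
  {v | Maximal (fun u => u ∈ T) v}

/-- The word of length `n` that encodes a boolean vector of size `n`. -/
def vectorWord {n : ℕ} (v : Fin n → Bool) : Word :=
  List.ofFn (fun i => if v i then 1 else 0)

/-- The word that encodes a list of boolean vectors of size `n`: first `n` in unary and a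
separator, then the vectors, each followed by a separator. -/
def familyWord (n : ℕ) (L : List (Fin n → Bool)) : Word :=
  List.replicate n 1 ++ [2] ++ L.flatMap (fun v => vectorWord v ++ [2])

/-- The problem of enumerating, given a finite set of boolean vectors of the same size, the
maximal elements of its closure by `F` without the vectors `(0, …, 0)` and `(1, …, 1)`. Words that
encode no set of vectors have no solutions. -/
def enumClosureMax (F : Set (Op Bool)) : EnumProblem := fun w =>
  {y | ∃ (n : ℕ) (L : List (Fin n → Bool)) (v : Fin n → Bool),
    w = familyWord n L ∧
    v ∈ maxElements (Cl F {u | u ∈ L} \ {fun _ => false, fun _ => true}) ∧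
    y = vectorWord v}

/-- The characteristic vector of a set of vertices. -/
def charVector {n : ℕ} (T : Finset (Fin n)) : Fin n → Bool := fun i => decide (i ∈ T)

/-- A set of vertices is independent in the hypergraph with set of hyperedges `E` if it contains
no hyperedge. -/
def IsIndependent {n : ℕ} (E : Set (Finset (Fin n))) (T : Finset (Fin n)) : Prop :=
  ∀ e ∈ E, ¬ e ⊆ T

/-- The problem of enumerating, given a hypergraph of dimension at most `k` (all of whose
hyperedges have at most `k` elements), its inclusion-maximal independent sets. A hypergraph with
vertices `0, …, n - 1` is encoded by the characteristic vectors of its hyperedges. Words that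
encode no such hypergraph have no solutions. -/
def enumKMaxIndSet (k : ℕ) : EnumProblem := fun w =>
  {y | ∃ (n : ℕ) (E : List (Finset (Fin n))) (T : Finset (Fin n)),
    w = familyWord n (E.map charVector) ∧
    (∀ e ∈ E, e.card ≤ k) ∧
    Maximal (IsIndependent {e | e ∈ E}) T ∧
    y = vectorWord (charVector T)}

end SetClosure

/-! ## A structured language for random access machines -/

namespace EnumComplexity

/-! Maximal elements of the two closures. `S10 k ⊆ S12 k`, because `x ∧ (y ∨ z) = x ∧ ((x ∧ (y → z))
→ z)`. Conversely, thresholds are monotone and `x ∧ (y → z) ≤ x`, so every vector of the larger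
closure lies below one of the smaller (`exists_le_of_mem_Cl_S12`). A cofinal subset has the same
maximal elements.

Equivalence, combinatorial side. A threshold is true iff at most one argument is false. By a
Baker-Pixley argument, a nonzero `T` lies below a vector of `Cl (S10 k) S` iff every `k` coordinates
of its support lie in the support of one vector of `S` (`Covered`; see `covered_of_mem_Cl` and
`exists_mem_Cl_ge`). The covered vectors are the independent sets of the hypergraph whose hyperedges
are the uncovered `k`-tuples. If the all-ones vector is not covered, the wanted vectors are the
nonzero maximal independent sets. If it is covered, the hypergraph has no hyperedge. When there is
at least one coordinate, the all-ones vector then belongs to the closure, which is thereby closed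
under union, and the wanted vectors are the maximal nonzero ones among the unions `unionAvoiding S
i`: at most `n` candidates, listed directly. With no coordinate nothing is wanted.

For the other reduction, a hypergraph with hyperedges of size at most `k` is sent to the family of
its independent sets of size at most `k`, with two more coordinates, constantly one and constantly
zero. These keep the solutions away from the zero and all-ones vectors, and the maximal vectors are
the extensions of the maximal independent sets (`IsTupleFamily.mem_maxElements`).

Complexity side. Every function and list of words used in the reductions is built from bounded loops
over polynomially bounded numbers. The predicates `Comp`, `Decid` and `Gen` are closed under these
constructions and yield machine programs. Both auxiliary problems are even solved in polynomial
total time, which bounds every delay. -/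

def Instr.IsJump : Instr → Prop
  | .jump _ => True
  | .jumpIfZero _ _ => True
  | _ => False

/-- Structured programs: instructions other than jumps, sequences, and loops that repeat their
body as long as a register is nonzero. -/
inductive Cmd : Type
  | instr (i : Instr) (hi : ¬ i.IsJump)
  | seq (a b : Cmd)
  | loop (x : ℕ) (body : Cmd)

/-- The instructions of a structured program that is placed at the address `p`. -/
def Cmd.compile : Cmd → ℕ → List Instr
  | .instr i _, _ => [i]
  | .seq a b, p => a.compile p ++ b.compile (p + (a.compile p).length)
  | .loop x b, p =>
      .jumpIfZero x (p + (b.compile (p + 1)).length + 2) :: (b.compile (p + 1) ++ [.jump p])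

/-- The configuration `c` after `t` more units of time. -/
def Config.delay (c : Config) (t : ℕ) : Config := { c with clock := c.clock + t }

/-- The big-step semantics of structured programs; program counters are irrelevant. -/
inductive Cmd.Run (w : Word) : Cmd → Config → Config → Prop
  | instr (i : Instr) (hi : ¬ i.IsJump) (c : Config) : Run w (.instr i hi) c (i.exec w c)
  | seq {a b : Cmd} {c d e : Config} (ha : Run w a c d) (hb : Run w b d e) :
      Run w (.seq a b) c e
  | loop_zero {x : ℕ} {b : Cmd} {c : Config} (hx : c.reg x = 0) : Run w (.loop x b) c (c.delay 1)
  | loop_succ {x : ℕ} {b : Cmd} {c d e : Config} (hx : c.reg x ≠ 0)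
      (hb : Run w b (c.delay (1 + (c.reg x).size)) d)
      (hl : Run w (.loop x b) (d.delay 1) e) : Run w (.loop x b) c e

theorem Program.step_of_append (pre post : List Instr) (i : Instr) (w : Word) (c : Config)
    (hc : c.pc = pre.length) : Program.step (pre ++ i :: post) w c = i.exec w c := by
  simp [Program.step, hc]

theorem Instr.exec_pc {i : Instr} (hi : ¬ i.IsJump) (w : Word) (c : Config) (p : ℕ) :
    i.exec w { c with pc := p } = { i.exec w c with pc := p + 1 } := by
  cases i <;> first | rfl | exact absurd trivial hi

/-- Jump targets are absolute addresses, so the simulation has to be stated for code placed between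
arbitrary `pre` and `post`; the induction moves neighbouring code into these two lists. -/
theorem Cmd.Run.iterate_step {w : Word} {a : Cmd} {c d : Config} (h : Cmd.Run w a c d) :
    ∀ pre post : List Instr, ∃ t : ℕ,
      (Program.step (pre ++ (a.compile pre.length ++ post)) w)^[t] { c with pc := pre.length } =
        { d with pc := pre.length + (a.compile pre.length).length } := by
  induction h with
  | instr i hi c =>
    intro pre post
    refine ⟨1, ?_⟩
    rw [Function.iterate_one]
    simp only [Cmd.compile, List.singleton_append, List.length_singleton]
    rw [Program.step_of_append _ _ _ _ _ rfl, Instr.exec_pc hi]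
  | @seq a b c d e _ _ iha ihb =>
    intro pre post
    obtain ⟨s, hs⟩ := iha pre (b.compile (pre.length + (a.compile pre.length).length) ++ post)
    obtain ⟨t, ht⟩ := ihb (pre ++ a.compile pre.length) post
    refine ⟨t + s, ?_⟩
    simp only [Cmd.compile, List.length_append, List.append_assoc] at hs ht ⊢
    rw [Function.iterate_add_apply, hs, ht, Nat.add_assoc]
  | @loop_zero x b c hx =>
    intro pre post
    refine ⟨1, ?_⟩
    rw [Function.iterate_one]
    simp only [Cmd.compile, List.cons_append]
    rw [Program.step_of_append _ _ _ _ _ rfl]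
    simp [Instr.exec, Instr.cost, hx, Config.delay, Nat.add_assoc]
  | @loop_succ x b c d e hx _ _ ihb ihl =>
    intro pre post
    -- For the body, the preceding code ends with the loop test and the following code begins with
    -- the jump back.
    obtain ⟨s, hs⟩ := ihb (pre ++ [.jumpIfZero x (pre.length + (b.compile (pre.length + 1)).length
      + 2)]) (.jump pre.length :: post)
    obtain ⟨t, ht⟩ := ihl pre post
    refine ⟨t + 1 + s + 1, ?_⟩
    simp only [Cmd.compile, List.length_append, List.append_assoc, List.cons_append,
      List.length_cons, List.length_nil, List.nil_append, Nat.zero_add] at hs ht ⊢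
    rw [Function.iterate_add_apply, Function.iterate_one,
      Program.step_of_append _ _ _ _ _ rfl]
    have h1 : Instr.exec w { c with pc := pre.length }
        (.jumpIfZero x (pre.length + (b.compile (pre.length + 1)).length + 2)) =
        { c.delay (1 + (c.reg x).size) with pc := pre.length + 1 } := by
      simp [Instr.exec, Instr.cost, hx, Config.delay]
    rw [h1, Function.iterate_add_apply, hs, Function.iterate_add_apply, Function.iterate_one]
    have h2 : Program.step (pre ++ .jumpIfZero x (pre.length +
          (b.compile (pre.length + 1)).length + 2) ::
          (b.compile (pre.length + 1) ++ .jump pre.length :: post)) w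
          { d with pc := pre.length + 1 + (b.compile (pre.length + 1)).length } =
        { d.delay 1 with pc := pre.length } := by
      have := Program.step_of_append (pre ++ .jumpIfZero x (pre.length +
          (b.compile (pre.length + 1)).length + 2) :: b.compile (pre.length + 1)) post
          (.jump pre.length) w
          { d with pc := pre.length + 1 + (b.compile (pre.length + 1)).length }
          (by simp; omega)
      simp only [List.append_assoc, List.cons_append] at this
      rw [this]
      rfl
    rw [h2, ht]

/-- A structured program run from the start gives a halting run of the compiled program. -/
theorem Cmd.Run.haltsIn {w : Word} {a : Cmd} {d : Config} (h : Cmd.Run w a Config.start d) :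
    Program.HaltsIn (a.compile 0) w { d with pc := (a.compile 0).length } := by
  obtain ⟨t, ht⟩ := h.iterate_step [] []
  refine ⟨le_rfl, t, ?_⟩
  simpa [Config.start] using ht

/-- The clock never decreases. This turns a bound on the total time into a bound on all delays. -/
theorem Program.HaltsIn.produced_le {P : Program} {w : Word} {c : Config} (h : P.HaltsIn w c) :
    ∀ x ∈ c.produced, x.1 ≤ c.clock := by
  obtain ⟨-, t, rfl⟩ := h
  induction t with
  | zero => simp [Config.start]
  | succ t ih =>
    rw [Function.iterate_succ_apply']
    generalize (P.step w)^[t] Config.start = c at ih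
    unfold Program.step
    split
    · exact ih
    · rename_i i _
      intro x hx
      have hle : c.clock ≤ (i.exec w c).clock := by cases i <;> simp [Instr.exec]
      cases i
      case output a =>
        simp only [Instr.exec, List.mem_append, List.mem_singleton] at hx
        rcases hx with hx | rfl
        · exact (ih x hx).trans hle
        · exact le_rfl
      all_goals exact (ih x hx).trans hle

end EnumComplexity

/-! ## Functions of the input word and of a few numbers that are computable in polynomial time -/

namespace EnumComplexity

/-- All numbers that occur are polynomially bounded, so this crude bound is enough to control the
logarithmic cost. -/
theorem size_le_self (n : ℕ) : n.size ≤ n := Nat.size_le.2 n.lt_two_pow_self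

/-- Tuples of numbers, serving as contexts in which expressions are evaluated. -/
class Ctx (α : Type) where
  size : ℕ
  get : α → ℕ → ℕ

instance : Ctx Unit := ⟨0, fun _ _ => 0⟩

/-- A context grows on the right, one component per enclosing loop; the newest counter has the
largest index, so older indices keep their meaning. -/
instance {α : Type} [Ctx α] : Ctx (α × ℕ) :=
  ⟨Ctx.size α + 1, fun a i => if i = Ctx.size α then a.2 else Ctx.get a.1 i⟩

section Context

variable {α : Type} [Ctx α]

/-- The length of the word and the numbers of the context are at most `N`. -/
def Bounded (w : Word) (a : α) (N : ℕ) : Prop :=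
  w.length ≤ N ∧ ∀ i < Ctx.size α, Ctx.get a i ≤ N

/-- The context is stored in the registers at the locations `l`. -/
def Holds (l : ℕ → ℕ) (a : α) (R : ℕ → ℕ) : Prop := ∀ i < Ctx.size α, R (l i) = Ctx.get a i

/-- The locations of a context lie strictly between zero and `D`. -/
def Located (α : Type) [Ctx α] (l : ℕ → ℕ) (D : ℕ) : Prop := ∀ i < Ctx.size α, 0 < l i ∧ l i < D

theorem Bounded.mono {w : Word} {a : α} {M N : ℕ} (h : Bounded w a M) (hMN : M ≤ N) :
    Bounded w a N := ⟨h.1.trans hMN, fun i hi => (h.2 i hi).trans hMN⟩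

theorem Bounded.pair {w : Word} {a : α} {i N : ℕ} (h : Bounded w a N) (hi : i ≤ N) :
    Bounded w (a, i) N := by
  refine ⟨h.1, fun j hj => ?_⟩
  simp only [Ctx.get]
  split_ifs with hji
  · exact hi
  · exact h.2 j (by simp only [Ctx.size] at hj; omega)

theorem Located.mono {l : ℕ → ℕ} {D E : ℕ} (h : Located α l D) (hDE : D ≤ E) : Located α l E :=
  fun i hi => ⟨(h i hi).1, (h i hi).2.trans_le hDE⟩

/-- A new loop counter is placed in a free register `D`. Locations are positive because register
zero is reserved for the length of the word being output. -/
theorem Located.pair {l : ℕ → ℕ} {D E : ℕ} (h : Located α l D) (h0 : 0 < D) (hDE : D < E) :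
    Located (α × ℕ) (Function.update l (Ctx.size α) D) E := by
  intro i hi
  by_cases hia : i = Ctx.size α
  · simp [hia, h0, hDE]
  · have := h i (by simp only [Ctx.size] at hi; omega)
    simp only [ne_eq, hia, not_false_eq_true, Function.update_of_ne]
    omega

theorem Holds.congr {l : ℕ → ℕ} {a : α} {R Q : ℕ → ℕ} {D : ℕ} (h : Holds l a R)
    (hl : Located α l D) (hRQ : ∀ r, 0 < r → r < D → Q r = R r) : Holds l a Q :=
  fun i hi => (hRQ _ (hl i hi).1 (hl i hi).2).trans (h i hi)

theorem Holds.pair {l : ℕ → ℕ} {a : α} {R : ℕ → ℕ} {D : ℕ} (h : Holds l a R) :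
    Holds (Function.update l (Ctx.size α) D) (a, R D) R := by
  intro i hi
  by_cases hia : i = Ctx.size α
  · simp [hia, Ctx.get]
  · have := h i (by simp only [Ctx.size] at hi; omega)
    simpa [hia, Ctx.get] using this

end Context

/-- The command `m`, run from `c`, computes the number `v` into the register `D` in time `T`,
without changing anything but registers from `D` on. -/
def Evaluates (w : Word) (m : Cmd) (D v T : ℕ) (c : Config) : Prop :=
  ∃ d : Config, m.Run w c d ∧ (∀ r < D, d.reg r = c.reg r) ∧ d.reg D = v ∧ d.out = c.out ∧
    d.produced = c.produced ∧ d.clock ≤ c.clock + T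

/-- `F` is computable in polynomial time, for contexts of polynomially bounded numbers. -/
structure Comp {α : Type} [Ctx α] (F : Word → α → ℕ) : Prop where
  bound : ∃ p : Polynomial ℕ, ∀ (w : Word) (a : α) (N : ℕ), Bounded w a N → F w a ≤ p.eval N
  code : ∀ (D : ℕ) (l : ℕ → ℕ), 0 < D → Located α l D → ∃ (m : Cmd) (q : Polynomial ℕ),
    ∀ (w : Word) (a : α) (N : ℕ) (c : Config), Bounded w a N → Holds l a c.reg →
      Evaluates w m D (F w a) (q.eval N) c

/-- The loop that runs `b` with the register `x` ranging over the numbers below the one that is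
computed by `m` into the register `x + 1`. -/
def forCmd (x : ℕ) (m b : Cmd) : Cmd :=
  .seq m (.seq (.instr (.const x 0) id) (.loop (x + 1) (.seq b (.seq (.instr (.const (x + 2) 1) id)
    (.seq (.instr (.add x x (x + 2)) id) (.instr (.sub (x + 1) (x + 1) (x + 2)) id))))))

/-- Register `x` counts up, `x + 1` counts the remaining rounds down, and `x + 2` holds the constant
one. By `hInv` the invariant only sees registers below `x`, the output registers and the words
produced, so this bookkeeping cannot break it. The term `3 * n + 10` pays for the test, the two
counter updates and the jump, both counters being at most `n`. -/
theorem run_loop {w : Word} {x n T : ℕ} {b : Cmd} {Inv : ℕ → Config → Prop}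
    (hInv : ∀ i c d, Inv i c → (∀ r < x, d.reg r = c.reg r) → d.out = c.out →
      d.produced = c.produced → Inv i d)
    (hb : ∀ i < n, ∀ c, Inv i c → c.reg x = i → ∃ d, b.Run w c d ∧ Inv (i + 1) d ∧
      d.reg x = c.reg x ∧ d.reg (x + 1) = c.reg (x + 1) ∧ d.clock ≤ c.clock + T) :
    ∀ (k i : ℕ), i + k = n → ∀ c, Inv i c → c.reg x = i → c.reg (x + 1) = k →
    ∃ d, (Cmd.loop (x + 1) (.seq b (.seq (.instr (.const (x + 2) 1) id)
      (.seq (.instr (.add x x (x + 2)) id) (.instr (.sub (x + 1) (x + 1) (x + 2)) id))))).Run w c d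
      ∧ Inv n d ∧ d.clock ≤ c.clock + k * (T + 3 * n + 10) + 1 := by
  intro k
  induction k with
  | zero =>
    rintro i rfl c hi hx hx1
    refine ⟨_, .loop_zero hx1, hInv _ _ _ hi (fun _ _ => rfl) rfl rfl, ?_⟩
    simp [Config.delay]
  | succ k ih =>
    rintro i hik c hi hx hx1
    obtain ⟨d, hd, hid, hdx, hdx1, hdt⟩ := hb i (by omega) (c.delay (1 + (c.reg (x + 1)).size))
      (hInv _ _ _ hi (fun _ _ => rfl) rfl rfl) hx
    set e : Config := Instr.exec w (Instr.exec w (Instr.exec w d (.const (x + 2) 1))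
      (.add x x (x + 2))) (.sub (x + 1) (x + 1) (x + 2)) with he
    have hx' : d.reg x = i := hdx.trans hx
    have hx1' : d.reg (x + 1) = k + 1 := hdx1.trans hx1
    obtain ⟨f, hf, hfi, hft⟩ := ih (i + 1) (by omega) (e.delay 1)
      (hInv _ _ _ hid (fun r hr => by
        have h1 : r ≠ x := by omega
        have h2 : r ≠ x + 1 := by omega
        have h3 : r ≠ x + 2 := by omega
        simp [he, Instr.exec, Config.delay, h1, h2, h3]) rfl rfl)
      (by simp [he, Instr.exec, Config.delay, hx'])
      (by simp [he, Instr.exec, Config.delay, hx1'])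
    refine ⟨f, .loop_succ (by omega) (.seq hd (.seq (.instr _ _ _) (.seq (.instr _ _ _)
      (.instr _ _ _)))) hf, hfi, hft.trans ?_⟩
    have h1 := size_le_self i
    have h2 := size_le_self (k + 1)
    have h3 := size_le_self 1
    have het : e.clock ≤ d.clock + (i + (k + 1) + 7) := by
      simp [he, Instr.exec, Instr.cost, hx', hx1']
      omega
    have hdt' : d.clock ≤ c.clock + (1 + (k + 1)) + T := by
      refine hdt.trans ?_
      simp only [Config.delay, hx1]
      omega
    have hed : (e.delay 1).clock = e.clock + 1 := rfl
    rw [hed, Nat.add_one_mul k]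
    omega

theorem run_for {w : Word} {x n T S : ℕ} {m b : Cmd} {Inv : ℕ → Config → Prop} {c : Config}
    (hInv : ∀ i c d, Inv i c → (∀ r < x, d.reg r = c.reg r) → d.out = c.out →
      d.produced = c.produced → Inv i d)
    (hm : Evaluates w m (x + 1) n S c) (h0 : Inv 0 c)
    (hb : ∀ i < n, ∀ c, Inv i c → c.reg x = i → ∃ d, b.Run w c d ∧ Inv (i + 1) d ∧
      d.reg x = c.reg x ∧ d.reg (x + 1) = c.reg (x + 1) ∧ d.clock ≤ c.clock + T) :
    ∃ d, (forCmd x m b).Run w c d ∧ Inv n d ∧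
      d.clock ≤ c.clock + (S + n * (T + 3 * n + 10) + 2) := by
  obtain ⟨d, hd, hdr, hdx, hdo, hdp, hdt⟩ := hm
  obtain ⟨e, he, hei, het⟩ := run_loop hInv hb n 0 (by omega) (Instr.exec w d (.const x 0))
    (hInv _ _ _ h0 (fun r hr => by
      have h1 : r ≠ x := by omega
      simp [Instr.exec, h1, hdr r (by omega)]) hdo hdp)
    (by simp [Instr.exec]) (by simp [Instr.exec, hdx])
  refine ⟨e, .seq hd (.seq (.instr _ _ _) he), hei, het.trans ?_⟩
  simp only [Instr.exec, Instr.cost, Nat.size_zero]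
  omega

/-! ### Closure properties of polynomial-time arithmetic. -/

namespace Comp

variable {α : Type} [Ctx α]

theorem const (k : ℕ) : Comp (fun (_ : Word) (_ : α) => k) where
  bound := ⟨.C k, by simp⟩
  code D l hD hl := ⟨.instr (.const D k) id, .C (1 + k.size), fun w a N c _ _ =>
    ⟨_, .instr _ _ _, fun r hr => by simp [Instr.exec, hr.ne], by simp [Instr.exec], rfl, rfl, by
      simp [Instr.exec, Instr.cost]⟩⟩

theorem length : Comp (fun (w : Word) (_ : α) => w.length) where
  bound := ⟨.X, fun w a N h => by simpa using h.1⟩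
  code D l hD hl := ⟨.instr (.inputLength D) id, .X + 1, fun w a N c h _ =>
    ⟨_, .instr _ _ _, fun r hr => by simp [Instr.exec, hr.ne], by simp [Instr.exec], rfl, rfl, by
      have := size_le_self w.length
      have := h.1
      simp [Instr.exec, Instr.cost]
      omega⟩⟩

/-- One proof for the three arithmetic instructions: the first operand waits in register `D` while
the second is evaluated from `D + 1` on. -/
theorem binary (mk : ℕ → ℕ → ℕ → Instr) (f : ℕ → ℕ → ℕ) (hj : ∀ d a b, ¬ (mk d a b).IsJump)
    (hexec : ∀ w c d a b, (mk d a b).exec w c = { c with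
      pc := c.pc + 1
      clock := c.clock + (1 + (c.reg a).size + (c.reg b).size)
      reg := Function.update c.reg d (f (c.reg a) (c.reg b)) })
    {F G : Word → α → ℕ} (hF : Comp F) (hG : Comp G)
    (hb : ∃ p : Polynomial ℕ, ∀ (w : Word) (a : α) (N : ℕ), Bounded w a N →
      f (F w a) (G w a) ≤ p.eval N) :
    Comp (fun w a => f (F w a) (G w a)) where
  bound := hb
  code D l hD hl := by
    obtain ⟨p₁, hp₁⟩ := hF.bound
    obtain ⟨p₂, hp₂⟩ := hG.bound
    obtain ⟨m₁, q₁, hm₁⟩ := hF.code D l hD hl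
    obtain ⟨m₂, q₂, hm₂⟩ := hG.code (D + 1) l (by omega) (hl.mono (by omega))
    refine ⟨.seq m₁ (.seq m₂ (.instr (mk D D (D + 1)) (hj _ _ _))), q₁ + q₂ + p₁ + p₂ + 1,
      fun w a N c hN hc => ?_⟩
    obtain ⟨d, hd, hdr, hdx, hdo, hdp, hdt⟩ := hm₁ w a N c hN hc
    obtain ⟨e, he, her, hex, heo, hep, het⟩ := hm₂ w a N d hN
      (hc.congr hl fun r _ hr => hdr r hr)
    refine ⟨_, .seq hd (.seq he (.instr _ _ _)), ?_, ?_, ?_, ?_, ?_⟩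
    · intro r hr
      simp [hexec, hr.ne, her r (by omega), hdr r hr]
    · simp [hexec, hex, her D (by omega), hdx]
    · simp [hexec, heo, hdo]
    · simp [hexec, hep, hdp]
    · have h1 := (size_le_self (F w a)).trans (hp₁ w a N hN)
      have h2 := (size_le_self (G w a)).trans (hp₂ w a N hN)
      simp only [hexec, hex, her D (by omega), hdx, Polynomial.eval_add, Polynomial.eval_one]
      omega

theorem add {F G : Word → α → ℕ} (hF : Comp F) (hG : Comp G) :
    Comp (fun w a => F w a + G w a) := by
  refine binary .add (· + ·) (fun _ _ _ => id) (fun _ _ _ _ _ => rfl) hF hG ?_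
  obtain ⟨p, hp⟩ := hF.bound
  obtain ⟨q, hq⟩ := hG.bound
  exact ⟨p + q, fun w a N h => by simpa using Nat.add_le_add (hp w a N h) (hq w a N h)⟩

theorem sub {F G : Word → α → ℕ} (hF : Comp F) (hG : Comp G) :
    Comp (fun w a => F w a - G w a) := by
  refine binary .sub (· - ·) (fun _ _ _ => id) (fun _ _ _ _ _ => rfl) hF hG ?_
  obtain ⟨p, hp⟩ := hF.bound
  exact ⟨p, fun w a N h => (Nat.sub_le _ _).trans (hp w a N h)⟩

theorem mul {F G : Word → α → ℕ} (hF : Comp F) (hG : Comp G) :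
    Comp (fun w a => F w a * G w a) := by
  refine binary .mul (· * ·) (fun _ _ _ => id) (fun _ _ _ _ _ => rfl) hF hG ?_
  obtain ⟨p, hp⟩ := hF.bound
  obtain ⟨q, hq⟩ := hG.bound
  exact ⟨p * q, fun w a N h => by simpa using Nat.mul_le_mul (hp w a N h) (hq w a N h)⟩

theorem read {F : Word → α → ℕ} (hF : Comp F) :
    Comp (fun w a => (w.getD (F w a) 0).val) where
  bound := ⟨.C 2, fun w a N _ => by simpa using Nat.le_of_lt_succ (w.getD (F w a) 0).isLt⟩
  code D l hD hl := by
    obtain ⟨p, hp⟩ := hF.bound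
    obtain ⟨m, q, hm⟩ := hF.code D l hD hl
    refine ⟨.seq m (.instr (.read D D) id), q + p + 1, fun w a N c hN hc => ?_⟩
    obtain ⟨d, hd, hdr, hdx, hdo, hdp, hdt⟩ := hm w a N c hN hc
    refine ⟨_, .seq hd (.instr _ _ _), ?_, ?_, hdo, hdp, ?_⟩
    · intro r hr
      simp [Instr.exec, hr.ne, hdr r hr]
    · simp [Instr.exec, hdx]
    · have h1 := (size_le_self (F w a)).trans (hp w a N hN)
      simp only [Instr.exec, Instr.cost, hdx, Polynomial.eval_add, Polynomial.eval_one]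
      omega

theorem var : Comp (fun (_ : Word) (a : α × ℕ) => a.2) where
  bound := ⟨.X, fun w a N h => by simpa [Ctx.get] using h.2 (Ctx.size α) (by simp [Ctx.size])⟩
  code D l hD hl := by
    -- There is no copy instruction: the variable is added to a register just set to zero.
    refine ⟨.seq (.instr (.const D 0) id) (.instr (.add D (l (Ctx.size α)) D) id), .X + 2,
      fun w a N c hN hc => ?_⟩
    have hs : Ctx.size α < Ctx.size (α × ℕ) := by simp [Ctx.size]
    have h1 := (hl _ hs).2
    have h2 : c.reg (l (Ctx.size α)) = a.2 := by simpa [Ctx.get] using hc _ hs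
    have h3 : a.2 ≤ N := by simpa [Ctx.get] using hN.2 _ hs
    have h4 := size_le_self a.2
    refine ⟨_, .seq (.instr _ _ _) (.instr _ _ _), ?_, ?_, rfl, rfl, ?_⟩
    · intro r hr
      simp [Instr.exec, hr.ne]
    · simp [Instr.exec, h1.ne, h2]
    · simp [Instr.exec, Instr.cost, h1.ne, h2]
      omega

theorem weaken {F : Word → α → ℕ} (hF : Comp F) :
    Comp (fun (w : Word) (a : α × ℕ) => F w a.1) := by
  have key : ∀ i < Ctx.size α, i < Ctx.size (α × ℕ) ∧ ∀ a : α × ℕ, Ctx.get a i = Ctx.get a.1 i :=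
    fun i hi => ⟨by simp only [Ctx.size]; omega, fun a => by simp [Ctx.get, hi.ne]⟩
  have hBd : ∀ {w : Word} {a : α × ℕ} {N : ℕ}, Bounded w a N → Bounded w a.1 N := fun {w a N} h =>
    ⟨h.1, fun i hi => (key i hi).2 a ▸ h.2 i (key i hi).1⟩
  refine ⟨?_, fun D l hD hl => ?_⟩
  · obtain ⟨p, hp⟩ := hF.bound
    exact ⟨p, fun w a N h => hp w a.1 N (hBd h)⟩
  · obtain ⟨m, q, hm⟩ := hF.code D l hD fun i hi => hl i (key i hi).1
    exact ⟨m, q, fun w a N c hN hc => hm w a.1 N c (hBd hN)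
      fun i hi => (hc i (key i hi).1).trans ((key i hi).2 a)⟩

/-- The only loop construct for numbers: bounded quantifiers, counting and division are all derived
from it. -/
theorem sum {F : Word → α → ℕ} {G : Word → α → ℕ → ℕ} (hF : Comp F)
    (hG : Comp (fun (w : Word) (a : α × ℕ) => G w a.1 a.2)) :
    Comp (fun w a => ∑ i ∈ Finset.range (F w a), G w a i) := by
  obtain ⟨p, hp⟩ := hF.bound
  obtain ⟨q, hq⟩ := hG.bound
  -- Partial sums need a bound too, since they are operands of the additions. The counter enlarges
  -- the bound on the context from `N` to `N + p.eval N`.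
  have hsum : ∀ (w : Word) (a : α) (N : ℕ), Bounded w a N → ∀ k ≤ F w a,
      ∑ i ∈ Finset.range k, G w a i ≤ p.eval N * q.eval (N + p.eval N) := by
    intro w a N h k hk
    have hpN := hp w a N h
    refine (Finset.sum_le_card_nsmul _ _ (q.eval (N + p.eval N)) fun i hi => ?_).trans ?_
    · have hi' := Finset.mem_range.1 hi
      exact hq w (a, i) _ ((h.mono (by omega)).pair (by omega))
    · rw [Finset.card_range, smul_eq_mul]
      exact Nat.mul_le_mul_right _ (by omega)
  refine ⟨⟨p * q.comp (.X + p), fun w a N h => by simpa using hsum w a N h _ le_rfl⟩,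
    fun D l hD hl => ?_⟩
  obtain ⟨m₁, q₁, hm₁⟩ := hF.code (D + 2) l (by omega) (hl.mono (by omega))
  obtain ⟨m₂, q₂, hm₂⟩ := hG.code (D + 3) (Function.update l (Ctx.size α) (D + 1)) (by omega)
    ((hl.mono (Nat.le_succ D)).pair (by omega) (by omega))
  let T : Polynomial ℕ := q₂.comp (.X + p) + p * q.comp (.X + p) + q.comp (.X + p) + 1
  refine ⟨.seq (.instr (.const D 0) id) (forCmd (D + 1) m₁ (.seq m₂
    (.instr (.add D D (D + 3)) id))), q₁ + p * (T + 3 * p + 10) + 3, fun w a N c hN hc => ?_⟩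
  have hpN := hp w a N hN
  set c' := Instr.exec w c (.const D 0) with hc'
  have hcr : ∀ r < D, c'.reg r = c.reg r := fun r hr => by simp [hc', Instr.exec, hr.ne]
  have hct : c'.clock = c.clock + 1 := by simp [hc', Instr.exec, Instr.cost]
  let Inv : ℕ → Config → Prop := fun k d => (∀ r < D, d.reg r = c.reg r) ∧
    d.reg D = ∑ i ∈ Finset.range k, G w a i ∧ d.out = c.out ∧ d.produced = c.produced
  obtain ⟨d, hd, hdI, hdt⟩ := run_for (Inv := Inv) (x := D + 1) (T := T.eval N)
    (b := .seq m₂ (.instr (.add D D (D + 3)) id))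
    (fun i c d h hr ho hp => ⟨fun r hrD => (hr r (by omega)).trans (h.1 r hrD),
      (hr D (by omega)).trans h.2.1, ho.trans h.2.2.1, hp.trans h.2.2.2⟩)
    (hm₁ w a N c' hN (hc.congr hl fun r _ hr => hcr r hr))
    ⟨hcr, by simp [hc', Instr.exec], rfl, rfl⟩ (by
      rintro i hi d ⟨hdr, hdD, hdo, hdp⟩ rfl
      have hb : Bounded w (a, d.reg (D + 1)) (N + p.eval N) :=
        (hN.mono (by omega)).pair (by omega)
      obtain ⟨e, he, her, hex, heo, hep, het⟩ := hm₂ w (a, d.reg (D + 1)) (N + p.eval N) d hb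
        (Holds.pair (hc.congr hl fun r _ hr => hdr r hr))
      have hGb := hq w _ _ hb
      have hS := hsum w a N hN _ hi.le
      have h1 := size_le_self (G w a (d.reg (D + 1)))
      have h2 := size_le_self (∑ i ∈ Finset.range (d.reg (D + 1)), G w a i)
      refine ⟨_, .seq he (.instr _ _ _), ⟨?_, ?_, heo.trans hdo, hep.trans hdp⟩, ?_, ?_, ?_⟩
      · intro r hr
        simp [Instr.exec, hr.ne, her r (by omega), hdr r hr]
      · simp [Instr.exec, her D (by omega), hdD, hex, Finset.sum_range_succ]
      · simp [Instr.exec, her (D + 1) (by omega)]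
      · simp [Instr.exec, Function.update_of_ne (show D + 1 + 1 ≠ D by omega),
          her (D + 1 + 1) (by omega)]
      · simp only [Instr.exec, Instr.cost, her D (by omega), hdD, hex, T, Polynomial.eval_add,
          Polynomial.eval_mul, Polynomial.eval_comp, Polynomial.eval_X, Polynomial.eval_one]
        simp only at hGb
        omega)
  refine ⟨d, .seq (.instr _ _ _) hd, hdI.1, hdI.2.1, hdI.2.2.1, hdI.2.2.2, hdt.trans ?_⟩
  rw [hct]
  simp only [Polynomial.eval_add, Polynomial.eval_mul, Polynomial.eval_ofNat]
  have : F w a * (T.eval N + 3 * F w a + 10) ≤ p.eval N * (T.eval N + 3 * p.eval N + 10) := by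
    gcongr
  omega

end Comp

end EnumComplexity

/-! ## Lists of words that can be output in polynomial time -/

namespace EnumComplexity

/-- The effect of an event on the word in the output registers and on the list of the words that
were output: a letter is appended to the word, and `none` outputs the word and erases it. -/
def applyEvent (s : List Letter × List Word) : Option Letter → List Letter × List Word
  | some a => (s.1 ++ [a], s.2)
  | none => ([], s.2 ++ [s.1])

def applyEvents (s : List Letter × List Word) (e : List (Option Letter)) :
    List Letter × List Word := e.foldl applyEvent s

theorem applyEvents_append (s : List Letter × List Word) (e f : List (Option Letter)) :
    applyEvents s (e ++ f) = applyEvents (applyEvents s e) f := List.foldl_append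

theorem applyEvents_length (s : List Letter × List Word) (e : List (Option Letter)) :
    (applyEvents s e).1.length ≤ s.1.length + e.length := by
  induction e generalizing s with
  | nil => simp [applyEvents]
  | cons a e ih =>
    refine (ih (applyEvent s a)).trans ?_
    cases a <;> simp [applyEvent] <;> omega

/-- The events that output the word `u`. -/
def outputEvents (u : Word) : List (Option Letter) := u.map some ++ [none]

theorem applyEvents_map_some (s : List Letter × List Word) (u : Word) :
    applyEvents s (u.map some) = (s.1 ++ u, s.2) := by
  induction u generalizing s with
  | nil => simp [applyEvents]
  | cons a u ih =>
    have := ih (s.1 ++ [a], s.2)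
    simpa [applyEvents, applyEvent] using this

theorem applyEvents_outputEvents (ws : List Word) (u : Word) :
    applyEvents ([], ws) (outputEvents u) = ([], ws ++ [u]) := by
  rw [outputEvents, applyEvents_append, applyEvents_map_some]
  simp [applyEvents, applyEvent]

theorem applyEvents_flatMap (ws us : List Word) :
    applyEvents ([], ws) (us.flatMap outputEvents) = ([], ws ++ us) := by
  induction us generalizing ws with
  | nil => simp [applyEvents]
  | cons u us ih => rw [List.flatMap_cons, applyEvents_append, applyEvents_outputEvents, ih]; simp

/-- In the configuration `c`, the register zero holds the length of the word in the output
registers. -/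
def Shows (c : Config) (s : List Letter × List Word) : Prop :=
  c.reg 0 = s.1.length ∧ (List.range s.1.length).map c.out = s.1 ∧ c.produced.map Prod.snd = s.2

/-- `G` is a sequence of events that can be executed in polynomial time. -/
structure Gen {α : Type} [Ctx α] (G : Word → α → List (Option Letter)) : Prop where
  bound : ∃ p : Polynomial ℕ, ∀ (w : Word) (a : α) (N : ℕ), Bounded w a N →
    (G w a).length ≤ p.eval N
  code : ∀ (D : ℕ) (l : ℕ → ℕ), 0 < D → Located α l D → ∃ (m : Cmd) (q : Polynomial ℕ),
    ∀ (w : Word) (a : α) (N : ℕ) (s : List Letter × List Word) (c : Config), Bounded w a N →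
      s.1.length ≤ N → Holds l a c.reg → Shows c s →
      ∃ d, m.Run w c d ∧ (∀ r, 0 < r → r < D → d.reg r = c.reg r) ∧
        Shows d (applyEvents s (G w a)) ∧ d.clock ≤ c.clock + q.eval N

/-! ### Closure properties of polynomial-time output. -/

namespace Gen

variable {α : Type} [Ctx α]

theorem emit {F : Word → α → ℕ} (hF : Comp F) : Gen (fun w a => [some (Fin.ofNat 3 (F w a))]) where
  bound := ⟨1, by simp⟩
  code D l hD hl := by
    obtain ⟨p, hp⟩ := hF.bound
    obtain ⟨m, q, hm⟩ := hF.code D l hD hl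
    refine ⟨.seq m (.seq (.instr (.write 0 D) id) (.seq (.instr (.const (D + 1) 1) id)
      (.instr (.add 0 0 (D + 1)) id))), q + p + 2 * .X + 5, fun w a N s c hN hs hc hcs => ?_⟩
    obtain ⟨d, hd, hdr, hdx, hdo, hdp, hdt⟩ := hm w a N c hN hc
    have h0 : d.reg 0 = s.1.length := (hdr 0 hD).trans hcs.1
    refine ⟨_, .seq hd (.seq (.instr _ _ _) (.seq (.instr _ _ _) (.instr _ _ _))), ?_, ⟨?_, ?_, ?_⟩,
      ?_⟩
    · intro r hr hrD
      simp [Instr.exec, hr.ne', Function.update_of_ne (show r ≠ D + 1 by omega), hdr r hrD]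
    · simp [Instr.exec, applyEvents, applyEvent, h0]
    · simp only [Instr.exec, applyEvents, applyEvent, h0, hdx, hdo, List.foldl_cons, List.foldl_nil,
        List.length_append, List.length_singleton, List.range_succ, List.map_append, List.map_cons,
        List.map_nil, Function.update_self]
      congr 1
      conv_rhs => rw [← hcs.2.1]
      refine List.map_congr_left fun i hi => ?_
      rw [Function.update_of_ne (List.mem_range.1 hi).ne]
    · simpa [Instr.exec, applyEvents, applyEvent, hdp] using hcs.2.2
    · have h1 := (size_le_self (F w a)).trans (hp w a N hN)
      have h2 := (size_le_self s.1.length).trans hs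
      simp [Instr.exec, Instr.cost, h0, hdx]
      omega

theorem flush : Gen (fun (_ : Word) (_ : α) => [none]) where
  bound := ⟨1, by simp⟩
  code D l hD hl := by
    -- Erasing the word amounts to resetting its length: stale letters are overwritten before they
    -- can be output again.
    refine ⟨.seq (.instr (.output 0) id) (.instr (.const 0 0) id), 2 * .X + 2,
      fun w a N s c hN hs hc hcs => ?_⟩
    refine ⟨_, .seq (.instr _ _ _) (.instr _ _ _), ?_, ⟨?_, ?_, ?_⟩, ?_⟩
    · intro r hr hrD
      simp [Instr.exec, hr.ne']
    · simp [Instr.exec, applyEvents, applyEvent]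
    · simp [applyEvents, applyEvent]
    · simp [Instr.exec, applyEvents, applyEvent, hcs.1, hcs.2.1, hcs.2.2]
    · have h2 := (size_le_self s.1.length).trans hs
      simp [Instr.exec, Instr.cost, hcs.1]
      omega

theorem append {G H : Word → α → List (Option Letter)} (hG : Gen G) (hH : Gen H) :
    Gen (fun w a => G w a ++ H w a) := by
  obtain ⟨p, hp⟩ := hG.bound
  obtain ⟨p', hp'⟩ := hH.bound
  refine ⟨⟨p + p', fun w a N h => by simpa using Nat.add_le_add (hp w a N h) (hp' w a N h)⟩,
    fun D l hD hl => ?_⟩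
  obtain ⟨m, q, hm⟩ := hG.code D l hD hl
  obtain ⟨m', q', hm'⟩ := hH.code D l hD hl
  -- The second part may start with a word that is longer by `p.eval N`, so its time bound is taken
  -- at `N + p.eval N`.
  refine ⟨.seq m m', q + q'.comp (.X + p), fun w a N s c hN hs hc hcs => ?_⟩
  obtain ⟨d, hd, hdr, hds, hdt⟩ := hm w a N s c hN hs hc hcs
  have hl' := applyEvents_length s (G w a)
  have hpN := hp w a N hN
  obtain ⟨e, he, her, hes, het⟩ := hm' w a (N + p.eval N) (applyEvents s (G w a)) d
    (hN.mono (by omega)) (by omega) (hc.congr hl hdr) hds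
  refine ⟨e, .seq hd he, fun r h0 hr => (her r h0 hr).trans (hdr r h0 hr), ?_, ?_⟩
  · rwa [applyEvents_append]
  · simp only [Polynomial.eval_add, Polynomial.eval_comp, Polynomial.eval_X]
    omega

theorem flatMap_range {F : Word → α → ℕ} {G : Word → α → ℕ → List (Option Letter)} (hF : Comp F)
    (hG : Gen (fun (w : Word) (a : α × ℕ) => G w a.1 a.2)) :
    Gen (fun w a => (List.range (F w a)).flatMap (G w a)) := by
  obtain ⟨p, hp⟩ := hF.bound
  obtain ⟨q, hq⟩ := hG.bound
  have hsum : ∀ (w : Word) (a : α) (N : ℕ), Bounded w a N → ∀ k ≤ F w a,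
      ((List.range k).flatMap (G w a)).length ≤ p.eval N * q.eval (N + p.eval N) := by
    intro w a N h k hk
    have hpN := hp w a N h
    refine le_trans ?_ (Nat.mul_le_mul_right _ (hk.trans hpN))
    rw [List.length_flatMap]
    refine (List.sum_le_card_nsmul _ (q.eval (N + p.eval N)) ?_).trans (by simp)
    intro x hx
    obtain ⟨i, hi, rfl⟩ := List.mem_map.1 hx
    have hi' := List.mem_range.1 hi
    exact hq w (a, i) _ ((h.mono (by omega)).pair (by omega))
  refine ⟨⟨p * q.comp (.X + p), fun w a N h => by simpa using hsum w a N h _ le_rfl⟩,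
    fun D l hD hl => ?_⟩
  obtain ⟨m₁, q₁, hm₁⟩ := hF.code (D + 1) l (by omega) (hl.mono (by omega))
  obtain ⟨m₂, q₂, hm₂⟩ := hG.code (D + 2) (Function.update l (Ctx.size α) D) (by omega)
    (hl.pair (by omega) (by omega))
  -- The argument also accounts for the letters that earlier rounds may have left in the output
  -- registers.
  let T : Polynomial ℕ := q₂.comp (.X + p + p * q.comp (.X + p))
  refine ⟨forCmd D m₁ m₂, q₁ + p * (T + 3 * p + 10) + 2, fun w a N s c hN hs hc hcs => ?_⟩
  have hpN := hp w a N hN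
  let Inv : ℕ → Config → Prop := fun k d => (∀ r, 0 < r → r < D → d.reg r = c.reg r) ∧
    Shows d (applyEvents s ((List.range k).flatMap (G w a)))
  obtain ⟨d, hd, hdI, hdt⟩ := run_for (Inv := Inv) (x := D) (T := T.eval N) (b := m₂)
    (fun i c d h hr ho hp => ⟨fun r h0 hrD => (hr r (by omega)).trans (h.1 r h0 hrD),
      (hr 0 hD).trans h.2.1, by rw [ho]; exact h.2.2.1, by rw [hp]; exact h.2.2.2⟩)
    (hm₁ w a N c hN hc) ⟨fun _ _ _ => rfl, by simpa [applyEvents] using hcs⟩ (by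
      rintro i hi d ⟨hdr, hds⟩ rfl
      have hS := hsum w a N hN _ hi.le
      have hL := applyEvents_length s ((List.range (d.reg D)).flatMap (G w a))
      obtain ⟨e, he, her, hes, het⟩ := hm₂ w (a, d.reg D)
        (N + p.eval N + p.eval N * q.eval (N + p.eval N)) _ d
        ((hN.mono (by omega)).pair (by omega)) (by omega)
        (Holds.pair (hc.congr hl hdr)) hds
      refine ⟨e, he, ⟨fun r h0 hr => (her r h0 (by omega)).trans (hdr r h0 hr), ?_⟩,
        her _ (by omega) (by omega), her _ (by omega) (by omega), ?_⟩
      · rw [List.range_succ, List.flatMap_append, applyEvents_append]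
        simpa using hes
      · simpa [T] using het)
  refine ⟨d, hd, hdI.1, hdI.2, hdt.trans ?_⟩
  simp only [Polynomial.eval_add, Polynomial.eval_mul, Polynomial.eval_ofNat]
  have : F w a * (T.eval N + 3 * F w a + 10) ≤ p.eval N * (T.eval N + 3 * p.eval N + 10) := by
    gcongr
  omega

/-- A program for a sequence of events without further input. -/
theorem exists_program {G : Word → Unit → List (Option Letter)} (hG : Gen G) :
    ∃ (P : Program) (q : Polynomial ℕ), ∀ w : Word, ∃ c : Config, P.HaltsIn w c ∧
      c.clock ≤ q.eval w.length ∧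
      c.produced.map Prod.snd = (applyEvents ([], []) (G w ())).2 := by
  obtain ⟨m, q, hm⟩ := hG.code 1 id (by omega) (fun i hi => absurd hi (Nat.not_lt_zero i))
  refine ⟨m.compile 0, q, fun w => ?_⟩
  obtain ⟨d, hd, -, hds, hdt⟩ := hm w () w.length ([], []) Config.start
    ⟨le_rfl, fun i hi => absurd hi (Nat.not_lt_zero i)⟩ (by simp)
    (fun i hi => absurd hi (Nat.not_lt_zero i)) ⟨rfl, rfl, rfl⟩
  exact ⟨_, hd.haltsIn, by simpa [Config.start] using hdt, hds.2.2⟩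

end Gen

theorem PolyTime.of_gen {f : Word → Word} (h : Gen (fun w (_ : Unit) => outputEvents (f w))) :
    PolyTime f := by
  obtain ⟨P, q, hP⟩ := h.exists_program
  refine ⟨P, q, fun w => ?_⟩
  obtain ⟨c, hc, hct, hcp⟩ := hP w
  exact ⟨c, hc, hct, by rw [hcp, applyEvents_outputEvents]; rfl⟩

/-- Polynomial total time suffices: every time stamp is at most the final clock, hence exceeds its
predecessor by at most the same bound. -/
theorem DelayP.of_gen {f : Word → List Word} (hf : ∀ w, (f w).Nodup)
    (h : Gen (fun w (_ : Unit) => (f w).flatMap outputEvents)) :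
    DelayP (fun w => {y | y ∈ f w}) := by
  obtain ⟨P, q, hP⟩ := h.exists_program
  refine ⟨P, q, fun w => ?_⟩
  obtain ⟨c, hc, hct, hcp⟩ := hP w
  rw [applyEvents_flatMap, List.nil_append] at hcp
  refine ⟨c, hc, by rw [hcp]; exact hf w, by rw [hcp], ?_⟩
  have hle : ∀ t ∈ c.produced.map Prod.fst ++ [c.clock], t ≤ q.eval w.length := by
    intro t ht
    rcases List.mem_append.1 ht with ht | ht
    · obtain ⟨x, hx, rfl⟩ := List.mem_map.1 ht
      exact (hc.produced_le x hx).trans hct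
    · rw [List.mem_singleton.1 ht]
      exact hct
  generalize c.produced.map Prod.fst ++ [c.clock] = ts at hle
  generalize 0 = s
  induction ts generalizing s with
  | nil => exact .singleton s
  | cons t ts ih =>
    exact .cons_cons ((hle t (by simp)).trans (Nat.le_add_left _ _))
      (ih (fun t ht => hle t (List.mem_cons_of_mem _ ht)) t)

end EnumComplexity

/-! ## Predicates that are decidable in polynomial time, and words and lists of words -/

namespace EnumComplexity

open scoped Classical in
/-- `p` is decidable in polynomial time, for contexts of polynomially bounded numbers. -/
def Decid {α : Type} [Ctx α] (p : Word → α → Prop) : Prop :=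
  Comp (fun w a => if p w a then 1 else 0)

namespace Decid

variable {α : Type} [Ctx α]

theorem congr {p q : Word → α → Prop} (hp : Decid p) (h : ∀ w a, p w a ↔ q w a) : Decid q := by
  have : p = q := funext fun w => funext fun a => propext (h w a)
  exact this ▸ hp

theorem of_comp {F : Word → α → ℕ} (hF : Comp F) {p : Word → α → Prop}
    (h : ∀ w a, (p w a → F w a = 1) ∧ (¬ p w a → F w a = 0)) : Decid p := by
  have : F = fun w a => open scoped Classical in if p w a then 1 else 0 := by
    funext w a
    split_ifs with hp
    · exact (h w a).1 hp
    · exact (h w a).2 hp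
  rw [this] at hF
  exact hF

theorem comp {p : Word → α → Prop} [∀ w a, Decidable (p w a)] (hp : Decid p) :
    Comp (fun w a => if p w a then 1 else 0) := by
  unfold Decid at hp
  convert hp

theorem le {F G : Word → α → ℕ} (hF : Comp F) (hG : Comp G) : Decid (fun w a => F w a ≤ G w a) :=
  of_comp (.sub (.const 1) (.sub hF hG)) fun w a => ⟨by omega, by omega⟩

theorem lt {F G : Word → α → ℕ} (hF : Comp F) (hG : Comp G) : Decid (fun w a => F w a < G w a) :=
  le (.add hF (.const 1)) hG

theorem eq {F G : Word → α → ℕ} (hF : Comp F) (hG : Comp G) : Decid (fun w a => F w a = G w a) :=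
  of_comp (.sub (.const 1) (.add (.sub hF hG) (.sub hG hF))) fun w a => ⟨by omega, by omega⟩

theorem not {p : Word → α → Prop} (hp : Decid p) : Decid (fun w a => ¬ p w a) :=
  of_comp (.sub (.const 1) hp) fun w a => ⟨fun h => by simp [h], fun h => by simp [not_not.1 h]⟩

theorem and {p q : Word → α → Prop} (hp : Decid p) (hq : Decid q) :
    Decid (fun w a => p w a ∧ q w a) :=
  of_comp (.mul hp hq) fun w a => ⟨fun h => by simp [h.1, h.2], fun h => by
    rcases not_and_or.1 h with h | h <;> simp [h]⟩

theorem or {p q : Word → α → Prop} (hp : Decid p) (hq : Decid q) :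
    Decid (fun w a => p w a ∨ q w a) :=
  (hp.not.and hq.not).not.congr fun w a => by tauto

theorem imp {p q : Word → α → Prop} (hp : Decid p) (hq : Decid q) :
    Decid (fun w a => p w a → q w a) :=
  (hp.not.or hq).congr fun w a => by tauto

theorem iff {p q : Word → α → Prop} (hp : Decid p) (hq : Decid q) :
    Decid (fun w a => p w a ↔ q w a) :=
  ((hp.imp hq).and (hq.imp hp)).congr fun w a => by tauto

/-- The truth value is one minus the number of counterexamples, with truncated subtraction. -/
theorem forall_lt {F : Word → α → ℕ} (hF : Comp F) {p : Word → α → ℕ → Prop}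
    (hp : Decid (fun (w : Word) (a : α × ℕ) => p w a.1 a.2)) :
    Decid (fun w a => ∀ i < F w a, p w a i) := by
  classical
  have h := Comp.sum (G := fun w a i => if ¬ p w a i then 1 else 0) hF hp.not.comp
  refine of_comp (.sub (.const 1) h) fun w a => ⟨fun h => ?_, fun h => ?_⟩
  · rw [Finset.sum_eq_zero fun i hi => by simp [h i (Finset.mem_range.1 hi)], Nat.sub_zero]
  · push Not at h
    obtain ⟨i, hi, hpi⟩ := h
    have : (if ¬ p w a i then 1 else 0) ≤ ∑ i ∈ Finset.range (F w a), if ¬ p w a i then 1 else 0 :=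
      Finset.single_le_sum (f := fun i => if ¬ p w a i then 1 else 0)
        (fun _ _ => Nat.zero_le _) (Finset.mem_range.2 hi)
    rw [if_pos hpi] at this
    omega

theorem exists_lt {F : Word → α → ℕ} (hF : Comp F) {p : Word → α → ℕ → Prop}
    (hp : Decid (fun (w : Word) (a : α × ℕ) => p w a.1 a.2)) :
    Decid (fun w a => ∃ i < F w a, p w a i) :=
  (forall_lt (p := fun w a i => ¬ p w a i) hF hp.not).not.congr fun w a => by simp

/-- For a fixed `k` the quantifier is unrolled into a disjunction, so each disjunct may have its own
program. This serves for the digits of a number, whose position is an exponent that must be a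
constant. -/
theorem exists_fin {k : ℕ} {p : Fin k → Word → α → Prop} (hp : ∀ j, Decid (p j)) :
    Decid (fun w a => ∃ j, p j w a) := by
  induction k with
  | zero => exact of_comp (.const 0) fun w a => by simp
  | succ k ih =>
    exact ((hp 0).or (ih fun j => hp j.succ)).congr fun w a => by rw [Fin.exists_fin_succ]

end Decid

namespace Comp

variable {α : Type} [Ctx α]

theorem pow {F : Word → α → ℕ} (hF : Comp F) (k : ℕ) : Comp (fun w a => F w a ^ k) := by
  induction k with
  | zero => exact .const 1
  | succ k ih => exact ih.mul hF

/-- The quotient is the number of `q` with `(q + 1) * G ≤ F`. Requiring `0 < G` makes the count zero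
for a zero divisor, in accordance with the convention for division. -/
theorem div {F G : Word → α → ℕ} (hF : Comp F) (hG : Comp G) :
    Comp (fun w a => F w a / G w a) := by
  classical
  have h := Comp.sum (G := fun w a q => if 0 < G w a ∧ (q + 1) * G w a ≤ F w a then 1 else 0) hF
    (Decid.comp (.and (.lt (.const 0) hG.weaken)
      (.le (.mul (.add .var (.const 1)) hG.weaken) hF.weaken)))
  convert h using 3 with w a
  rw [← Finset.card_filter]
  rcases Nat.eq_zero_or_pos (G w a) with h0 | h0
  · simp [h0]
  · rw [show (Finset.range (F w a)).filter (fun q => 0 < G w a ∧ (q + 1) * G w a ≤ F w a) =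
      Finset.range (F w a / G w a) from ?_, Finset.card_range]
    ext q
    have h1 := Nat.le_div_iff_mul_le (x := q + 1) (y := F w a) h0
    have h2 := Nat.div_le_self (F w a) (G w a)
    simp only [Finset.mem_filter, Finset.mem_range, h0, true_and, ← h1]
    omega

theorem mod {F G : Word → α → ℕ} (hF : Comp F) (hG : Comp G) :
    Comp (fun w a => F w a % G w a) := by
  have h := hF.sub (hG.mul (hF.div hG))
  simpa only [← Nat.mod_eq_sub] using h

end Comp

/-- A conditional is a loop with one round or none, which is why its body lives in a context with an
additional, idle counter. -/
theorem Gen.ite {α : Type} [Ctx α] {p : Word → α → Prop} {dp : ∀ w a, Decidable (p w a)}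
    (hp : Decid p)
    {G : Word → α → List (Option Letter)} (hG : Gen (fun (w : Word) (a : α × ℕ) => G w a.1)) :
    Gen (fun w a => if p w a then G w a else []) := by
  convert Gen.flatMap_range (G := fun w a _ => G w a) hp.comp hG using 3 with w a
  split_ifs <;> simp

/-- A word that can be written in polynomial time. -/
def GenWord {α : Type} [Ctx α] (u : Word → α → Word) : Prop :=
  Gen (fun w a => (u w a).map some)

/-- A list of words that can be output in polynomial time. -/
def GenList {α : Type} [Ctx α] (L : Word → α → List Word) : Prop :=
  Gen (fun w a => (L w a).flatMap outputEvents)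

namespace GenWord

variable {α : Type} [Ctx α]

theorem letter {F : Word → α → ℕ} (hF : Comp F) : GenWord (fun w a => [Fin.ofNat 3 (F w a)]) :=
  Gen.emit hF

open scoped Classical in
theorem bit {p : Word → α → Prop} (hp : Decid p) :
    GenWord (fun w a => [if p w a then 1 else 0]) := by
  convert letter hp using 4 with w a
  split_ifs <;> rfl

theorem append {u v : Word → α → Word} (hu : GenWord u) (hv : GenWord v) :
    GenWord (fun w a => u w a ++ v w a) := by
  simpa only [GenWord, List.map_append] using Gen.append hu hv

theorem flatMap_range {F : Word → α → ℕ} {u : Word → α → ℕ → Word} (hF : Comp F)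
    (hu : GenWord (fun (w : Word) (a : α × ℕ) => u w a.1 a.2)) :
    GenWord (fun w a => (List.range (F w a)).flatMap (u w a)) := by
  simpa only [GenWord, List.map_flatMap] using
    Gen.flatMap_range (G := fun w a i => (u w a i).map some) hF hu

theorem ite {p : Word → α → Prop} {dp : ∀ w a, Decidable (p w a)} (hp : Decid p) {u : Word → α → Word}
    (hu : GenWord (fun (w : Word) (a : α × ℕ) => u w a.1)) :
    GenWord (fun w a => if p w a then u w a else []) := by
  have h := Gen.ite (dp := dp) (G := fun w a => (u w a).map some) hp hu
  simpa only [GenWord, apply_ite (List.map some), List.map_nil] using h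

end GenWord

namespace GenList

variable {α : Type} [Ctx α]

theorem singleton {u : Word → α → Word} (hu : GenWord u) : GenList (fun w a => [u w a]) := by
  simpa only [GenList, List.flatMap_singleton, outputEvents] using Gen.append hu .flush

theorem append {u v : Word → α → List Word} (hu : GenList u) (hv : GenList v) :
    GenList (fun w a => u w a ++ v w a) := by
  simpa only [GenList, List.flatMap_append] using Gen.append hu hv

theorem flatMap_range {F : Word → α → ℕ} {u : Word → α → ℕ → List Word} (hF : Comp F)
    (hu : GenList (fun (w : Word) (a : α × ℕ) => u w a.1 a.2)) :
    GenList (fun w a => (List.range (F w a)).flatMap (u w a)) := by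
  simpa only [GenList, List.flatMap_assoc] using
    Gen.flatMap_range (G := fun w a i => (u w a i).flatMap outputEvents) hF hu

theorem ite {p : Word → α → Prop} {dp : ∀ w a, Decidable (p w a)} (hp : Decid p) {u : Word → α → List Word}
    (hu : GenList (fun (w : Word) (a : α × ℕ) => u w a.1)) :
    GenList (fun w a => if p w a then u w a else []) := by
  have h := Gen.ite (dp := dp) (G := fun w a => (u w a).flatMap outputEvents) hp hu
  simpa only [GenList, apply_ite (List.flatMap outputEvents), List.flatMap_nil] using h

end GenList

theorem PolyTime.of_genWord {f : Word → Word} (h : GenWord (fun w (_ : Unit) => f w)) :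
    PolyTime f := .of_gen (Gen.append h .flush)

end EnumComplexity

/-! ## Words that encode families of vectors -/

namespace EnumComplexity

open SetClosure

theorem length_vectorWord {n : ℕ} (v : Fin n → Bool) : (vectorWord v).length = n := by
  simp [vectorWord]

theorem getD_vectorWord {n : ℕ} (v : Fin n → Bool) {i : ℕ} (hi : i < n) :
    (vectorWord v).getD i 0 = if v ⟨i, hi⟩ then 1 else 0 := by
  rw [List.getD_eq_getElem _ _ (by rwa [length_vectorWord])]
  simp [vectorWord]

theorem vectorWord_injective {n : ℕ} : Function.Injective (vectorWord (n := n)) := by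
  intro u v h
  funext i
  have := congrArg (fun w : Word => w.getD i 0) h
  simp only [getD_vectorWord _ i.isLt] at this
  cases hu : u i <;> cases hv : v i <;> simp_all

/-- The number of the letter of `w` at position `p`. -/
def letterAt (w : Word) (p : ℕ) : ℕ := (w.getD p 0).val

theorem letterAt_append_right (u y : Word) (i : ℕ) :
    letterAt (u ++ y) (u.length + i) = letterAt y i := by
  rw [letterAt, List.getD_append_right _ _ _ _ (Nat.le_add_right _ _), Nat.add_sub_cancel_left,
    letterAt]

theorem letterAt_vectorWord {n : ℕ} (v : Fin n → Bool) {i : ℕ} (hi : i < n) :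
    letterAt (vectorWord v) i = if v ⟨i, hi⟩ then 1 else 0 := by
  rw [letterAt, getD_vectorWord v hi]
  split_ifs <;> rfl

/-- The word `w` starts with the code of a family of `m` vectors of size `n`, followed by `r` more
letters. -/
def StartsWithFamily (w : Word) (n m r : ℕ) : Prop :=
  (m + 1) * (n + 1) + r = w.length ∧ (∀ i < n, letterAt w i = 1) ∧
    ∀ j < m + 1, ∀ i < n + 1, (letterAt w (j * (n + 1) + i) = 2 ↔ i = n)

/-- The entry `i` of the vector number `j`, in a word that starts with the code of a family of
vectors of size `n`. -/
def entry (w : Word) (n j i : ℕ) : Prop := letterAt w ((j + 1) * (n + 1) + i) = 1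

theorem length_familyWord (n : ℕ) (L : List (Fin n → Bool)) :
    (familyWord n L).length = (L.length + 1) * (n + 1) := by
  induction L with
  | nil => simp [familyWord]
  | cons v L ih =>
    simp only [familyWord, List.length_append, List.flatMap_cons, List.length_cons,
      List.length_nil, length_vectorWord] at ih ⊢
    rw [Nat.add_one_mul (L.length + 1)]
    omega

theorem letterAt_flatMap {n : ℕ} (L : List (Fin n → Bool)) (y : Word) {j i : ℕ}
    (hj : j < L.length) (hi : i < n + 1) :
    letterAt (L.flatMap (fun v => vectorWord v ++ [2]) ++ y) (j * (n + 1) + i) =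
      if h : i < n then (if L[j] ⟨i, h⟩ then 1 else 0) else 2 := by
  induction L generalizing j with
  | nil => simp at hj
  | cons v L ih =>
    have hl : (vectorWord v ++ [2]).length = n + 1 := by simp [length_vectorWord]
    rw [List.flatMap_cons, List.append_assoc]
    cases j with
    | zero =>
      simp only [Nat.zero_mul, Nat.zero_add, List.getElem_cons_zero]
      rw [letterAt, List.getD_append _ _ _ _ (by omega)]
      split_ifs with h hv
      · rw [List.getD_append _ _ _ _ (by rwa [length_vectorWord]), getD_vectorWord _ h, if_pos hv]
        rfl
      · rw [List.getD_append _ _ _ _ (by rwa [length_vectorWord]), getD_vectorWord _ h, if_neg hv]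
        rfl
      · obtain rfl : i = n := by omega
        rw [List.getD_append_right _ _ _ _ (by rw [length_vectorWord]), length_vectorWord]
        simp
    | succ j =>
      have := letterAt_append_right (vectorWord v ++ [2])
        (L.flatMap (fun v => vectorWord v ++ [2]) ++ y) (j * (n + 1) + i)
      rw [hl] at this
      rw [show (j + 1) * (n + 1) + i = n + 1 + (j * (n + 1) + i) by ring, this,
        ih (by simpa using hj)]
      rfl

theorem letterAt_familyWord_head {n : ℕ} (L : List (Fin n → Bool)) (y : Word) {i : ℕ}
    (hi : i < n + 1) : letterAt (familyWord n L ++ y) i = if i < n then 1 else 2 := by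
  have hl : (List.replicate n (1 : Letter) ++ [2]).length = n + 1 := by simp
  rw [familyWord, List.append_assoc, letterAt, List.getD_append _ _ _ _ (by omega)]
  split_ifs with h
  · rw [List.getD_append _ _ _ _ (by simpa using h), List.getD_replicate _ h]
    rfl
  · obtain rfl : i = n := by omega
    rw [List.getD_append_right _ _ _ _ (by simp)]
    simp

theorem letterAt_familyWord {n : ℕ} (L : List (Fin n → Bool)) (y : Word) {j i : ℕ}
    (hj : j < L.length) (hi : i < n + 1) :
    letterAt (familyWord n L ++ y) ((j + 1) * (n + 1) + i) =
      if h : i < n then (if L[j] ⟨i, h⟩ then 1 else 0) else 2 := by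
  have hl : (List.replicate n (1 : Letter) ++ [2]).length = n + 1 := by simp
  have := letterAt_append_right (List.replicate n (1 : Letter) ++ [2])
    (L.flatMap (fun v => vectorWord v ++ [2]) ++ y) (j * (n + 1) + i)
  rw [hl, letterAt_flatMap L y hj hi] at this
  rw [← this, familyWord, List.append_assoc]
  congr 1
  ring

theorem letterAt_familyWord_append {n : ℕ} (L : List (Fin n → Bool)) (y : Word) (i : ℕ) :
    letterAt (familyWord n L ++ y) ((L.length + 1) * (n + 1) + i) = letterAt y i := by
  rw [← length_familyWord, letterAt_append_right]

theorem startsWithFamily_familyWord {n : ℕ} (L : List (Fin n → Bool)) (y : Word) :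
    StartsWithFamily (familyWord n L ++ y) n L.length y.length := by
  refine ⟨by rw [List.length_append, length_familyWord], fun i hi => ?_, fun j hj i hi => ?_⟩
  · rw [letterAt_familyWord_head L y (by omega), if_pos hi]
  · cases j with
    | zero =>
      rw [Nat.zero_mul, Nat.zero_add, letterAt_familyWord_head L y hi]
      split_ifs with h <;> simp <;> omega
    | succ j =>
      rw [letterAt_familyWord L y (by omega) hi]
      split_ifs with h <;> simp <;> omega

theorem entry_familyWord {n : ℕ} (L : List (Fin n → Bool)) (y : Word) {j : ℕ}
    (hj : j < L.length) (i : Fin n) :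
    entry (familyWord n L ++ y) n j i ↔ L[j] i = true := by
  rw [entry, letterAt_familyWord L y hj (by omega), dif_pos i.isLt]
  cases L[j] i <;> simp

/-- The size is the position of the first separator; with the number of remaining letters known, the
length then determines the number of vectors. -/
theorem StartsWithFamily.size_unique {w : Word} {n m r n' m' r' : ℕ}
    (h : StartsWithFamily w n m r) (h' : StartsWithFamily w n' m' r') : n = n' := by
  have key : ∀ {n m r n' m' r' : ℕ}, StartsWithFamily w n m r → StartsWithFamily w n' m' r' →
      ¬ n < n' := by
    intro n m r n' m' r' h h' hlt
    have h1 := h'.2.1 n hlt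
    have h2 := (h.2.2 0 (by omega) n (by omega)).2 rfl
    rw [Nat.zero_mul, Nat.zero_add] at h2
    omega
  exact le_antisymm (not_lt.1 (key h' h)) (not_lt.1 (key h h'))

theorem StartsWithFamily.count_unique {w : Word} {n m r m' : ℕ}
    (h : StartsWithFamily w n m r) (h' : StartsWithFamily w n m' r) : m = m' := by
  have : (m + 1) * (n + 1) = (m' + 1) * (n + 1) := by
    have := h.1
    have := h'.1
    omega
  have := Nat.eq_of_mul_eq_mul_right (by omega) this
  omega

open scoped Classical in
/-- The vectors of the family that is encoded by a word. -/
noncomputable def rows (w : Word) (n m : ℕ) : List (Fin n → Bool) :=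
  (List.range m).map fun j i => decide (entry w n j i)

theorem length_rows (w : Word) (n m : ℕ) : (rows w n m).length = m := by simp [rows]

theorem getElem_rows {w : Word} {n m j : ℕ} (hj : j < (rows w n m).length) (i : Fin n) :
    (rows w n m)[j] i = true ↔ entry w n j i := by
  have h : (rows w n m)[j] = fun i : Fin n =>
      open scoped Classical in decide (entry w n ((List.range m)[j]'(by simpa [rows] using hj)) i) :=
    List.getElem_map _
  rw [h]
  simp

theorem rows_familyWord {n : ℕ} (L : List (Fin n → Bool)) (y : Word) :
    rows (familyWord n L ++ y) n L.length = L := by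
  refine List.ext_getElem (by simp [rows]) fun j h1 h2 => ?_
  funext i
  rw [Bool.eq_iff_iff, getElem_rows, entry_familyWord L y h2]

theorem eq_of_letterAt {u w : Word} (hl : u.length = w.length)
    (h : ∀ p < u.length, letterAt u p = letterAt w p) : u = w := by
  refine List.ext_getElem hl fun p h1 h2 => ?_
  have := h p h1
  simp only [letterAt] at this
  rw [List.getD_eq_getElem _ _ h1, List.getD_eq_getElem _ _ h2] at this
  exact Fin.ext this

theorem StartsWithFamily.eq_familyWord {w : Word} {n m : ℕ} (h : StartsWithFamily w n m 0) :
    w = familyWord n (rows w n m) := by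
  have hlen := length_rows w n m
  have hw := h.1
  refine eq_of_letterAt (by rw [length_familyWord, hlen, ← hw, Nat.add_zero]) fun p hp => ?_
  obtain ⟨j, i, hi, rfl⟩ : ∃ j i, i < n + 1 ∧ p = j * (n + 1) + i :=
    ⟨p / (n + 1), p % (n + 1), Nat.mod_lt _ (by omega), (Nat.div_add_mod' p (n + 1)).symm⟩
  have hj : j < m + 1 := by
    by_contra hj
    have := Nat.mul_le_mul_right (n + 1) (not_lt.1 hj)
    omega
  have h2 := h.2.2 j hj i hi
  rw [← List.append_nil (familyWord n _)]
  cases j with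
  | zero =>
    rw [Nat.zero_mul, Nat.zero_add] at h2 ⊢
    rw [letterAt_familyWord_head _ _ hi]
    split_ifs with hin
    · exact h.2.1 i hin
    · exact h2.2 (by omega)
  | succ j =>
    rw [letterAt_familyWord _ _ (by omega) hi]
    split_ifs with hin he
    · exact (getElem_rows _ ⟨i, hin⟩).1 he
    · have h3 : ¬ letterAt w ((j + 1) * (n + 1) + i) = 1  :=
        fun h => he ((getElem_rows _ ⟨i, hin⟩).2 h)
      -- A letter that is neither one nor the separator two is zero.
      have h4 : letterAt w ((j + 1) * (n + 1) + i) < 3 := Fin.isLt _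
      omega
    · exact h2.2 (by omega)

theorem familyWord_inj {n n' : ℕ} {L : List (Fin n → Bool)} {L' : List (Fin n' → Bool)}
    (h : familyWord n L = familyWord n' L') : ∃ hn : n = n', hn ▸ L = L' := by
  have h1 := startsWithFamily_familyWord L []
  have h2 := startsWithFamily_familyWord L' []
  rw [h] at h1
  obtain rfl := h1.size_unique h2
  refine ⟨rfl, ?_⟩
  have hm := h1.count_unique h2
  rw [← rows_familyWord L [], ← rows_familyWord L' [], h, hm]

/-- Parsing without a search instruction: one loops over all candidate parameters, and only the
correct one contributes. -/
theorem flatMap_range_eq {β : Type*} {N i₀ : ℕ} (h₀ : i₀ < N) {f : ℕ → List β}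
    (hf : ∀ i, i ≠ i₀ → f i = []) : (List.range N).flatMap f = f i₀ := by
  induction N with
  | zero => omega
  | succ N ih =>
    rw [List.range_succ, List.flatMap_append, List.flatMap_singleton]
    rcases Nat.lt_succ_iff_lt_or_eq.1 h₀ with h | rfl
    · rw [ih h, hf N (by omega), List.append_nil]
    · rw [List.flatMap_eq_nil_iff.2, List.nil_append]
      intro i hi
      exact hf i (List.mem_range.1 hi).ne

open scoped Classical in
/-- The list `f w n m` if `w` consists of the code of a family of `m` vectors of size `n` and of
`r n` more letters, and the empty list if `w` is not of this form. -/
noncomputable def onFamily {β : Type} (r : ℕ → ℕ) (f : Word → ℕ → ℕ → List β) (w : Word) :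
    List β :=
  (List.range (w.length + 1)).flatMap fun n => (List.range (w.length + 1)).flatMap fun m =>
    if StartsWithFamily w n m (r n) then f w n m else []

theorem onFamily_eq {β : Type} {r : ℕ → ℕ} (f : Word → ℕ → ℕ → List β) {w : Word} {n m : ℕ}
    (h : StartsWithFamily w n m (r n)) : onFamily r f w = f w n m := by
  have hn : n < w.length + 1 := by
    have := h.1
    have := Nat.le_mul_of_pos_left (n + 1) (show 0 < m + 1 by omega)
    omega
  have hm : m < w.length + 1 := by
    have := h.1
    have := Nat.le_mul_of_pos_right (m + 1) (show 0 < n + 1 by omega)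
    omega
  rw [onFamily, flatMap_range_eq hn, flatMap_range_eq hm, if_pos h]
  · intro m' hm'
    exact if_neg fun h' => hm' (h'.count_unique h)
  · intro n' hn'
    refine List.flatMap_eq_nil_iff.2 fun m' _ => if_neg fun h' => hn' (h'.size_unique h)

theorem onFamily_eq_nil {β : Type} {r : ℕ → ℕ} (f : Word → ℕ → ℕ → List β) {w : Word}
    (h : ∀ n m, ¬ StartsWithFamily w n m (r n)) : onFamily r f w = [] :=
  List.flatMap_eq_nil_iff.2 fun n _ => List.flatMap_eq_nil_iff.2 fun m _ => if_neg (h n m)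

section Computability

variable {α : Type} [Ctx α]

theorem Comp.letterAt {F : Word → α → ℕ} (hF : Comp F) : Comp (fun w a => letterAt w (F w a)) :=
  hF.read

theorem Decid.entry {n j i : Word → α → ℕ} (hn : Comp n) (hj : Comp j) (hi : Comp i) :
    Decid (fun w a => entry w (n w a) (j w a) (i w a)) :=
  .eq (.letterAt (.add (.mul (.add hj (.const 1)) (.add hn (.const 1))) hi)) (.const 1)

theorem Decid.startsWithFamily {n m r : Word → α → ℕ} (hn : Comp n) (hm : Comp m) (hr : Comp r) :
    Decid (fun w a => StartsWithFamily w (n w a) (m w a) (r w a)) :=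
  .and (.eq (.add (.mul (.add hm (.const 1)) (.add hn (.const 1))) hr) .length)
    (.and (.forall_lt hn (.eq (.letterAt .var) (.const 1)))
      (.forall_lt (.add hm (.const 1)) (.forall_lt (.add hn.weaken (.const 1))
        (.iff (.eq (.letterAt (.add (.mul (.weaken .var) (.add hn.weaken.weaken (.const 1))) .var))
          (.const 2)) (.eq .var hn.weaken.weaken)))))

open scoped Classical in
theorem vectorWord_decide (n : ℕ) (p : ℕ → Prop) :
    vectorWord (fun i : Fin n => decide (p i)) =
      (List.range n).flatMap fun i => [if p i then 1 else 0] := by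
  rw [← List.map_eq_flatMap]
  refine List.ext_getElem (by simp [length_vectorWord]) fun i h1 h2 => ?_
  simp [SetClosure.vectorWord]

open scoped Classical in
theorem GenWord.vectorWord {n : Word → α → ℕ} (hn : Comp n) {p : Word → α → ℕ → Prop}
    (hp : Decid (fun (w : Word) (a : α × ℕ) => p w a.1 a.2)) :
    GenWord (fun w a => vectorWord (fun i : Fin (n w a) => decide (p w a i))) := by
  simp only [vectorWord_decide]
  exact GenWord.flatMap_range (u := fun w a i => [if p w a i then 1 else 0]) hn (GenWord.bit hp)

open scoped Classical in
/-- The vectors of size `n` with the entries given by `v`, for the indices below `N` that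
satisfy `p`. -/
noncomputable def selection (n N : ℕ) (p : ℕ → Prop) (v : ℕ → ℕ → Prop) : List (Fin n → Bool) :=
  ((List.range N).filter (fun t => p t)).map fun t i => decide (v t i)

theorem mem_selection {n N : ℕ} {p : ℕ → Prop} {v : ℕ → ℕ → Prop} {u : Fin n → Bool} :
    u ∈ selection n N p v ↔ ∃ t < N, p t ∧ ∀ i : Fin n, u i = true ↔ v t i := by
  classical
  simp only [selection, List.mem_map, List.mem_filter, List.mem_range, decide_eq_true_eq]
  refine exists_congr fun t => ?_
  rw [and_assoc, funext_iff]
  refine and_congr_right fun _ => and_congr_right fun _ => forall_congr' fun i => ?_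
  rw [Bool.eq_iff_iff, decide_eq_true_iff]
  exact Iff.comm

open scoped Classical in
theorem flatMap_selection {β : Type} (n N : ℕ) (p : ℕ → Prop) (v : ℕ → ℕ → Prop)
    (f : (Fin n → Bool) → List β) : (selection n N p v).flatMap f =
      (List.range N).flatMap fun t => if p t then f (fun i => decide (v t i)) else [] := by
  rw [selection]
  induction List.range N with
  | nil => rfl
  | cons t l ih =>
    by_cases h : p t <;> simp [h] at ih ⊢ <;> exact ih

/-- The three variables added in the context of `v` are the index of the vector, the idle counter of
the conditional, and the coordinate. -/
theorem GenWord.familyWord {n N : Word → α → ℕ} (hn : Comp n) (hN : Comp N)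
    {p : Word → α → ℕ → Prop} (hp : Decid (fun (w : Word) (a : α × ℕ) => p w a.1 a.2))
    {v : Word → α → ℕ → ℕ → Prop}
    (hv : Decid (fun (w : Word) (a : ((α × ℕ) × ℕ) × ℕ) => v w a.1.1.1 a.1.1.2 a.2)) :
    GenWord (fun w a => familyWord (n w a) (selection (n w a) (N w a) (p w a) (v w a))) := by
  classical
  have h1 := GenWord.flatMap_range (u := fun _ _ _ => [1]) hn (GenWord.letter (.const 1))
  have h2 := GenWord.flatMap_range (u := fun w a t => if p w a t then
    SetClosure.vectorWord (fun i : Fin (n w a) => decide (v w a t i)) ++ [2] else []) hN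
    (GenWord.ite hp (GenWord.append (GenWord.vectorWord hn.weaken.weaken hv)
      (GenWord.letter (.const 2))))
  have h := (h1.append (GenWord.letter (.const 2))).append h2
  have hr : ∀ n : ℕ, List.replicate n (1 : Letter) = (List.range n).flatMap fun _ => [1] := by
    intro n
    rw [← List.map_eq_flatMap, List.map_const', List.length_range]
  simp only [SetClosure.familyWord, flatMap_selection, hr]
  exact h

theorem GenWord.onFamily {r : ℕ → ℕ} {f : Word → ℕ → ℕ → Word}
    (hr : ∀ {β : Type} [Ctx β] {n : Word → β → ℕ}, Comp n → Comp (fun w b => r (n w b)))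
    (hf : ∀ {β : Type} [Ctx β] {n m : Word → β → ℕ}, Comp n → Comp m →
      GenWord (fun w b => f w (n w b) (m w b))) :
    GenWord (fun w (_ : α) => onFamily r f w) :=
  .flatMap_range (.add .length (.const 1)) (.flatMap_range (.add .length (.const 1))
    (.ite (.startsWithFamily (.weaken .var) .var (hr (.weaken .var)))
      (hf (.weaken (.weaken .var)) (.weaken .var))))

theorem GenList.onFamily {r : ℕ → ℕ} {f : Word → ℕ → ℕ → List Word}
    (hr : ∀ {β : Type} [Ctx β] {n : Word → β → ℕ}, Comp n → Comp (fun w b => r (n w b)))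
    (hf : ∀ {β : Type} [Ctx β] {n m : Word → β → ℕ}, Comp n → Comp m →
      GenList (fun w b => f w (n w b) (m w b))) :
    GenList (fun w (_ : α) => onFamily r f w) :=
  .flatMap_range (.add .length (.const 1)) (.flatMap_range (.add .length (.const 1))
    (.ite (.startsWithFamily (.weaken .var) .var (hr (.weaken .var)))
      (hf (.weaken (.weaken .var)) (.weaken .var))))

end Computability

end EnumComplexity

/-! ## The closures by the clones `S_10^k` and `S_12^k` -/

namespace SetClosure

/-! ### Closure under a clone and under its generators. -/

section Clone

variable {D : Type} {F G : Set (Op D)} {n : ℕ} {S : Set (Fin n → D)}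

theorem InCl.mono {u : Fin n → D} (hFG : F ⊆ G) (h : InCl F S u) : InCl G S u := by
  induction h with
  | base v hv => exact .base v hv
  | app t f hf v _ ih => exact .app t f (hFG hf) v ih

theorem InCl.app_clone {f : Op D} (hf : f ∈ clone F) :
    ∀ v : Fin f.1 → Fin n → D, (∀ j, InCl F S (v j)) → InCl F S (fun i => f.2 (fun j => v j i)) := by
  induction hf with
  | base f hf => exact fun v hv => .app f.1 f.2 hf v hv
  | proj t i => exact fun v hv => hv i
  | comp s t f g _ _ ihf ihg => exact fun v hv => ihf _ fun j => ihg j v hv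

/-- Reduces inductions over the closure to the generating operations. -/
theorem InCl.of_clone {u : Fin n → D} (h : InCl (clone F) S u) : InCl F S u := by
  induction h with
  | base v hv => exact .base v hv
  | app t f hf v _ ih => exact InCl.app_clone hf v ih

theorem clone_mono_of_subset (h : F ⊆ clone G) : clone F ⊆ clone G := by
  intro f hf
  induction hf with
  | base f hf => exact h hf
  | proj t i => exact .proj t i
  | comp s t f g _ _ ihf ihg => exact .comp s t f g ihf ihg

end Clone

/-! ### Comparison of the two clones and of their closures. -/

theorem threshold_eq_true {k : ℕ} (x : Fin (k + 1) → Bool) :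
    (threshold k).2 x = true ↔ ∀ i j, x i = false → x j = false → i = j := by
  have h : (Finset.univ.filter fun i => x i = true).card +
      (Finset.univ.filter fun i => ¬ x i = true).card = k + 1 := by
    rw [Finset.card_filter_add_card_filter_not, Finset.card_univ, Fintype.card_fin]
  have h1 : k ≤ (Finset.univ.filter fun i => x i = true).card ↔
      (Finset.univ.filter fun i => ¬ x i = true).card ≤ 1 := by omega
  refine decide_eq_true_iff.trans (h1.trans ?_)
  rw [Finset.card_le_one]
  simp only [Finset.mem_filter, Finset.mem_univ, true_and, Bool.not_eq_true]
  exact ⟨fun h i j hi hj => h i hi j hj, fun h i hi j hj => h i j hi hj⟩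

theorem threshold_mem_S10 (k : ℕ) : threshold k ∈ S10 k := by
  refine .base _ ?_
  split_ifs <;> simp

theorem andOr_mem_S10 {k : ℕ} (hk : 2 ≤ k) : andOr ∈ S10 k := by
  rcases hk.eq_or_lt with rfl | hk
  · exact .base _ (by simp)
  -- The threshold is applied to `y, z, x, …, x`. As `k ≥ 3` there are at least two copies of `x`,
  -- so at most one argument is false iff `x` holds and one of `y`, `z` does.
  · let g : Fin (k + 1) → (Fin 3 → Bool) → Bool := fun j x =>
      if j.val = 0 then x 1 else if j.val = 1 then x 2 else x 0
    have hg : (fun x : Fin 3 → Bool => x 0 && (x 1 || x 2)) =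
        fun x => (threshold k).2 fun j : Fin (k + 1) => g j x := by
      funext x
      refine Bool.eq_iff_iff.2 (Iff.trans ?_ (threshold_eq_true (fun j => g j x)).symm)
      constructor
      · intro hx i j hi hj
        simp only [Bool.and_eq_true, Bool.or_eq_true] at hx
        ext
        simp only [g] at hi hj
        split_ifs at hi hj <;> simp_all
      · intro hx
        have h1 := hx ⟨2, by omega⟩ ⟨3, by omega⟩
        have h2 := hx ⟨0, by omega⟩ ⟨1, by omega⟩
        simp [g] at h1 h2
        cases h : x 0 <;> cases h' : x 1 <;> cases h'' : x 2 <;> simp_all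
    have h : (⟨3, fun x => (threshold k).2 fun j : Fin (k + 1) => g j x⟩ : Op Bool) ∈ S10 k := by
      refine InClone.comp (k + 1) 3 (threshold k).2 g (threshold_mem_S10 k) fun j => ?_
      simp only [g]
      split_ifs <;> first | exact .proj 3 1 | exact .proj 3 2 | exact .proj 3 0
    rw [← hg] at h
    exact h

theorem S10_subset_S12 (k : ℕ) : S10 k ⊆ S12 k := by
  refine clone_mono_of_subset fun f hf => ?_
  have h : f = threshold k ∨ f = andOr := by
    split_ifs at hf
    · exact hf
    · exact .inl hf
  rcases h with rfl | rfl
  · exact .base _ (by simp)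
  -- When `x` holds, `(y → z) → z` is `y ∨ z`; the premise is expressed by `andImp` itself as `x ∧
  -- (y → z)`.
  · let g : Fin 3 → (Fin 3 → Bool) → Bool :=
      ![fun x => x 0, fun x => x 0 && (!(x 1) || x 2), fun x => x 2]
    have hg : (fun x : Fin 3 → Bool => x 0 && (x 1 || x 2)) =
        fun x => andImp.2 fun j : Fin 3 => g j x := by
      funext x
      change (x 0 && (x 1 || x 2)) = (x 0 && (!(x 0 && (!(x 1) || x 2)) || x 2))
      cases x 0 <;> cases x 1 <;> cases x 2 <;> rfl
    have h : (⟨3, fun x => andImp.2 fun j : Fin 3 => g j x⟩ : Op Bool) ∈ S12 k := by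
      refine InClone.comp 3 3 andImp.2 g (.base _ (.inr rfl)) fun j => ?_
      fin_cases j
      · exact .proj 3 0
      · exact .base _ (.inr rfl)
      · exact .proj 3 2
    rw [← hg] at h
    exact h

variable {n k : ℕ} {S : Set (Fin n → Bool)}

theorem le_iff_imp {u v : Fin n → Bool} : u ≤ v ↔ ∀ i, u i = true → v i = true :=
  forall_congr' fun _ => Bool.le_iff_imp

theorem ne_false_iff {u : Fin n → Bool} : u ≠ (fun _ => false) ↔ ∃ i, u i = true := by
  simp [funext_iff]

theorem ne_true_iff {u : Fin n → Bool} : u ≠ (fun _ => true) ↔ ∃ i, u i = false := by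
  simp [funext_iff]

theorem threshold_mem_Cl {v : Fin (k + 1) → Fin n → Bool} (hv : ∀ j, v j ∈ Cl (S10 k) S) :
    (fun i => (threshold k).2 (fun j => v j i)) ∈ Cl (S10 k) S :=
  .app (k + 1) (threshold k).2 (threshold_mem_S10 k) v hv

theorem andOr_mem_Cl (hk : 2 ≤ k) {a b c : Fin n → Bool} (ha : a ∈ Cl (S10 k) S)
    (hb : b ∈ Cl (S10 k) S) (hc : c ∈ Cl (S10 k) S) :
    (fun i => a i && (b i || c i)) ∈ Cl (S10 k) S :=
  .app 3 andOr.2 (andOr_mem_S10 hk) ![a, b, c] fun j => by fin_cases j <;> assumption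

/-- A principle uniform in `k`: in both cases of the definition of `S10 k` the generators are among
these two operations. -/
theorem Cl_S10_induction {P : (Fin n → Bool) → Prop} {u : Fin n → Bool} (hu : u ∈ Cl (S10 k) S)
    (base : ∀ v ∈ S, P v)
    (threshold : ∀ v : Fin (k + 1) → Fin n → Bool, (∀ j, P (v j)) →
      P (fun i => (threshold k).2 (fun j => v j i)))
    (andOr : ∀ a b c : Fin n → Bool, P a → P b → P c → P (fun i => a i && (b i || c i))) :
    P u := by
  have h := InCl.of_clone hu
  clear hu
  induction h with
  | base v hv => exact base v hv
  | app t f hf v _ ih =>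
    have h : (⟨t, f⟩ : Op Bool) = SetClosure.threshold k ∨ (⟨t, f⟩ : Op Bool) = SetClosure.andOr := by
      split_ifs at hf
      · exact hf
      · exact .inl hf
    rcases h with h | h
    · cases h
      exact threshold v ih
    · cases h
      exact andOr _ _ _ (ih 0) (ih 1) (ih 2)

/-- Dominating vectors pass through thresholds by monotonicity; for `x ∧ (y → z)` the one that
dominates `x` will do. -/
theorem exists_le_of_mem_Cl_S12 {v : Fin n → Bool} (hv : v ∈ Cl (S12 k) S) :
    ∃ u ∈ Cl (S10 k) S, v ≤ u := by
  have h := InCl.of_clone hv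
  clear hv
  induction h with
  | base v hv => exact ⟨v, .base v hv, le_rfl⟩
  | app t f hf v _ ih =>
    rcases hf with h | h
    · cases h
      choose u hu hvu using ih
      refine ⟨_, threshold_mem_Cl hu, le_iff_imp.2 fun i hi => ?_⟩
      refine (threshold_eq_true _).2 fun j j' hj hj' => (threshold_eq_true _).1 hi j j' ?_ ?_
      · exact Bool.eq_false_of_not_eq_true fun h => by simp [le_iff_imp.1 (hvu j) i h] at hj
      · exact Bool.eq_false_of_not_eq_true fun h => by simp [le_iff_imp.1 (hvu j') i h] at hj'
    · cases h
      obtain ⟨u, hu, hvu⟩ := ih 0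
      refine ⟨u, hu, le_iff_imp.2 fun i hi => le_iff_imp.1 hvu i ?_⟩
      exact (Bool.and_eq_true_iff.1 hi).1

theorem maxElements_eq_of_cofinal {A B : Set (Fin n → Bool)} (hAB : A ⊆ B)
    (h : ∀ b ∈ B, ∃ a ∈ A, b ≤ a) : maxElements A = maxElements B := by
  ext v
  constructor
  · rintro ⟨hv, hmax⟩
    refine ⟨hAB hv, fun u hu hvu => ?_⟩
    obtain ⟨a, ha, hua⟩ := h u hu
    exact hua.trans (hmax ha (hvu.trans hua))
  · rintro ⟨hv, hmax⟩
    obtain ⟨a, ha, hva⟩ := h v hv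
    obtain rfl := le_antisymm hva (hmax (hAB ha) hva)
    exact ⟨ha, fun u hu hvu => hmax (hAB hu) hvu⟩

theorem maxElements_Cl_S10_eq (k n : ℕ) (S : Set (Fin n → Bool)) :
    maxElements (Cl (S10 k) S) = maxElements (Cl (S12 k) S) :=
  maxElements_eq_of_cofinal (fun _ hu => InCl.mono (S10_subset_S12 k) hu)
    fun _ hv => exists_le_of_mem_Cl_S12 hv

/-- Every `k` elements of the support of `T` belong to the support of a vector of `S`. -/
def Covered (k : ℕ) (S : Set (Fin n → Bool)) (T : Fin n → Bool) : Prop :=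
  ∀ d : Fin k → Fin n, (∀ j, T (d j) = true) → ∃ s ∈ S, ∀ j, s (d j) = true

theorem Covered.anti {T U : Fin n → Bool} (h : Covered k S U) (hTU : T ≤ U) : Covered k S T :=
  fun d hd => h d fun j => le_iff_imp.1 hTU _ (hd j)

/-- Pigeonhole: if none of the `k + 1` arguments contains the `k` given coordinates, two arguments
vanish at the same coordinate, and the threshold is false there. -/
theorem covered_of_mem_Cl {v : Fin n → Bool} (hv : v ∈ Cl (S10 k) S) : Covered k S v := by
  refine Cl_S10_induction hv (fun v hv d hd => ⟨v, hv, hd⟩) (fun v ih d hd => ?_)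
    fun a b c ha _ _ => ha.anti (le_iff_imp.2 fun i hi => (Bool.and_eq_true_iff.1 hi).1)
  by_contra h
  have hc : ∀ i : Fin (k + 1), ∃ j, v i (d j) = false := by
    intro i
    by_contra! hi
    exact h (ih i d fun j => Bool.eq_true_of_not_eq_false (hi j))
  choose c hc using hc
  obtain ⟨i, i', hne, hii⟩ := Fintype.exists_ne_map_eq_of_card_lt c (by simp)
  exact hne ((threshold_eq_true _).1 (hd (c i)) i i' (hc i) (hii ▸ hc i'))

/-- Smaller sets are padded by repetition, which requires an element to repeat. -/
theorem exists_tuple {e : Finset (Fin n)} (he : e.Nonempty) (hk : e.card ≤ k) :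
    ∃ d : Fin k → Fin n, ∀ i, i ∈ e ↔ ∃ j, d j = i := by
  have := he.to_subtype
  obtain ⟨f⟩ := Function.Embedding.nonempty_of_card_le (α := e) (β := Fin k) (by simpa using hk)
  have hs := Function.invFun_surjective f.injective
  refine ⟨fun j => (Function.invFun f j).val, fun i => ⟨fun hi => ?_, ?_⟩⟩
  · obtain ⟨j, hj⟩ := hs ⟨i, hi⟩
    exact ⟨j, congrArg Subtype.val hj⟩
  · rintro ⟨j, rfl⟩
    exact (Function.invFun f j).2

/-- Baker-Pixley induction. If `e` has more than `k` elements, pick `k + 1` of them and, for each, a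
vector of the closure containing the rest of `e`. At each coordinate of `e` at most one of these
vectors vanishes, so their threshold contains all of `e`. -/
theorem exists_mem_Cl_of_finset (hk : 2 ≤ k) {T : Fin n → Bool} (hT : Covered k S T)
    (e : Finset (Fin n)) (he : e.Nonempty) (heT : ∀ i ∈ e, T i = true) :
    ∃ u ∈ Cl (S10 k) S, ∀ i ∈ e, u i = true := by
  induction e using Finset.strongInduction with
  | H e ih =>
    rcases le_or_gt e.card k with hc | hc
    · obtain ⟨d, hd⟩ := exists_tuple he hc
      obtain ⟨s, hs, hsd⟩ := hT d fun j => heT _ ((hd _).2 ⟨j, rfl⟩)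
      refine ⟨s, .base s hs, fun i hi => ?_⟩
      obtain ⟨j, rfl⟩ := (hd i).1 hi
      exact hsd j
    · obtain ⟨a⟩ := Function.Embedding.nonempty_of_card_le (α := Fin (k + 1)) (β := e)
        (by simpa using hc)
      have h : ∀ i, ∃ u ∈ Cl (S10 k) S, ∀ b ∈ e.erase (a i).val, u b = true := by
        intro i
        refine ih _ (Finset.erase_ssubset (a i).2) ?_ fun b hb => heT b (Finset.mem_of_mem_erase hb)
        rw [← Finset.card_pos, Finset.card_erase_of_mem (a i).2]
        omega
      choose u hu hue using h
      refine ⟨_, threshold_mem_Cl hu, fun b hb => (threshold_eq_true _).2 fun i j hi hj => ?_⟩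
      have key : ∀ i, u i b = false → (a i).val = b := by
        intro i hi
        by_contra hne
        rw [hue i b (Finset.mem_erase.2 ⟨fun h => hne h.symm, hb⟩)] at hi
        exact Bool.noConfusion hi
      exact a.injective (Subtype.ext ((key i hi).trans (key j hj).symm))

theorem exists_mem_Cl_ge (hk : 2 ≤ k) {T : Fin n → Bool} (hT : Covered k S T)
    (h0 : T ≠ fun _ => false) : ∃ u ∈ Cl (S10 k) S, T ≤ u := by
  obtain ⟨i, hi⟩ := ne_false_iff.1 h0
  obtain ⟨u, hu, hTu⟩ := exists_mem_Cl_of_finset hk hT (Finset.univ.filter fun i => T i = true)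
    ⟨i, by simpa using hi⟩ (by simp)
  exact ⟨u, hu, le_iff_imp.2 fun i hi => hTu i (by simpa using hi)⟩

/-- The maximal vectors of the closure if it does not contain the vector `(1, …, 1)`. -/
theorem mem_maxElements_of_not_covered (hk : 2 ≤ k) (h : ¬ Covered k S fun _ => true)
    {y : Fin n → Bool} :
    y ∈ maxElements (Cl (S10 k) S \ {fun _ => false, fun _ => true}) ↔
      y ≠ (fun _ => false) ∧ Maximal (Covered k S) y := by
  -- Vectors of the closure are covered, so removing the all-ones vector has no effect; only the
  -- zero vector matters.
  have h1 : ∀ u, Covered k S u → u ≠ fun _ => true := by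
    rintro u hu rfl
    exact h hu
  constructor
  · rintro ⟨⟨hy, hy01⟩, hmax⟩
    simp only [Set.mem_insert_iff, Set.mem_singleton_iff, not_or] at hy01
    refine ⟨hy01.1, covered_of_mem_Cl hy, fun T hT hyT => ?_⟩
    have hT0 : T ≠ fun _ => false := by
      obtain ⟨i, hi⟩ := ne_false_iff.1 hy01.1
      exact ne_false_iff.2 ⟨i, le_iff_imp.1 hyT i hi⟩
    obtain ⟨u, hu, hTu⟩ := exists_mem_Cl_ge hk hT hT0
    have hu0 : u ≠ fun _ => false := by
      obtain ⟨i, hi⟩ := ne_false_iff.1 hT0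
      exact ne_false_iff.2 ⟨i, le_iff_imp.1 hTu i hi⟩
    exact hTu.trans (hmax ⟨hu, by simp [hu0, h1 u (covered_of_mem_Cl hu)]⟩ (hyT.trans hTu))
  · rintro ⟨hy0, hy, hmax⟩
    obtain ⟨u, hu, hyu⟩ := exists_mem_Cl_ge hk hy hy0
    obtain rfl := le_antisymm hyu (hmax (covered_of_mem_Cl hu) hyu)
    exact ⟨⟨hu, by simp [hy0, h1 y hy]⟩, fun v hv hyv => hmax (covered_of_mem_Cl hv.1) hyv⟩

open scoped Classical in
/-- The union of the supports of the vectors of `S` that vanish at `i`. -/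
noncomputable def unionAvoiding (S : Set (Fin n → Bool)) (i : Fin n) : Fin n → Bool :=
  fun l => decide (∃ s ∈ S, s i = false ∧ s l = true)

theorem unionAvoiding_eq_true {i l : Fin n} :
    unionAvoiding S i l = true ↔ ∃ s ∈ S, s i = false ∧ s l = true := by
  simp [unionAvoiding]

theorem unionAvoiding_ne_true (i : Fin n) : unionAvoiding S i ≠ fun _ => true := by
  refine ne_true_iff.2 ⟨i, Bool.eq_false_of_not_eq_true fun h => ?_⟩
  obtain ⟨s, -, h0, h1⟩ := unionAvoiding_eq_true.1 h
  simp [h0] at h1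

/-- The implication from coordinate `l` to coordinate `i` is preserved by the monotone generators,
so it cannot hold throughout `S` and fail in the closure. -/
theorem exists_separating {v : Fin n → Bool} (hv : v ∈ Cl (S10 k) S) {i l : Fin n}
    (hi : v i = false) (hl : v l = true) : ∃ s ∈ S, s i = false ∧ s l = true := by
  by_contra! h
  suffices hP : v l = true → v i = true by simp [hP hl] at hi
  refine Cl_S10_induction (P := fun v => v l = true → v i = true) hv
    (fun v hv hl => Bool.eq_true_of_not_eq_false fun hi => h v hv hi hl) (fun v ih hl => ?_)
    fun a b c ha hb hc hl => ?_
  · refine (threshold_eq_true _).2 fun j j' hj hj' => (threshold_eq_true _).1 hl j j' ?_ ?_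
    · exact Bool.eq_false_of_not_eq_true fun h => by simp [ih j h] at hj
    · exact Bool.eq_false_of_not_eq_true fun h => by simp [ih j' h] at hj'
  · simp only [Bool.and_eq_true, Bool.or_eq_true] at hl ⊢
    exact ⟨ha hl.1, hl.2.imp hb hc⟩

theorem le_unionAvoiding {v : Fin n → Bool} (hv : v ∈ Cl (S10 k) S) {i : Fin n}
    (hi : v i = false) : v ≤ unionAvoiding S i :=
  le_iff_imp.2 fun _ hl => unionAvoiding_eq_true.2 (exists_separating hv hi hl)

/-- With the all-ones vector as `x`, the operation `x ∧ (y ∨ z)` becomes a union; a nonzero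
`unionAvoiding S i` is a union of a nonempty finite family. -/
theorem unionAvoiding_mem_Cl (hk : 2 ≤ k) (h1 : (fun _ => true) ∈ Cl (S10 k) S) {i : Fin n}
    (hi : unionAvoiding S i ≠ fun _ => false) : unionAvoiding S i ∈ Cl (S10 k) S := by
  classical
  obtain ⟨l, hl⟩ := ne_false_iff.1 hi
  obtain ⟨s, hs, hsi, -⟩ := unionAvoiding_eq_true.1 hl
  have hne : (Finset.univ.filter fun s => s ∈ S ∧ s i = false).Nonempty := ⟨s, by simp [hs, hsi]⟩
  have h := Finset.sup'_mem (Cl (S10 k) S) (fun a ha b hb => by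
    have := andOr_mem_Cl hk h1 ha hb
    simp only [Bool.true_and] at this
    exact this) _ hne id
    (fun s hs => InCl.base s (Finset.mem_filter.1 hs).2.1)
  convert h
  refine le_antisymm (le_iff_imp.2 fun l hl => ?_) (Finset.sup'_le _ _ fun s hs => ?_)
  · obtain ⟨s, hs, hsi, hsl⟩ := unionAvoiding_eq_true.1 hl
    exact le_iff_imp.1 (Finset.le_sup' id (by simp [hs, hsi] : s ∈ _)) l hsl
  · have := (Finset.mem_filter.1 hs).2
    exact le_iff_imp.2 fun l hl => unionAvoiding_eq_true.2 ⟨s, this.1, this.2, hl⟩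

/-- The maximal vectors of the closure if it contains the vector `(1, …, 1)`. -/
theorem mem_maxElements_of_covered (hk : 2 ≤ k) (h : Covered k S fun _ => true)
    {y : Fin n → Bool} :
    y ∈ maxElements (Cl (S10 k) S \ {fun _ => false, fun _ => true}) ↔
      ∃ i, y = unionAvoiding S i ∧ y ≠ (fun _ => false) ∧
        ∀ j, y ≤ unionAvoiding S j → unionAvoiding S j ≤ y := by
  -- A coordinate is needed: for `n = 0` the all-ones vector equals the zero vector, and the closure
  -- of the empty family does not contain it.
  have h1 : Fin n → (fun _ => true) ∈ Cl (S10 k) S := by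
    intro i
    obtain ⟨u, hu, hTu⟩ := exists_mem_Cl_ge hk h (ne_false_iff.2 ⟨i, rfl⟩)
    exact (funext fun i => le_iff_imp.1 hTu i rfl : u = fun _ => true) ▸ hu
  have h0 : ∀ {u v : Fin n → Bool}, u ≠ (fun _ => false) → u ≤ v → v ≠ fun _ => false := by
    intro u v hu huv
    obtain ⟨i, hi⟩ := ne_false_iff.1 hu
    exact ne_false_iff.2 ⟨i, le_iff_imp.1 huv i hi⟩
  have hM : ∀ i, unionAvoiding S i ≠ (fun _ => false) →
      unionAvoiding S i ∈ Cl (S10 k) S \ {fun _ => false, fun _ => true} := fun i hi =>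
    ⟨unionAvoiding_mem_Cl hk (h1 i) hi, by simp [hi, unionAvoiding_ne_true i]⟩
  constructor
  · rintro ⟨⟨hy, hy01⟩, hmax⟩
    simp only [Set.mem_insert_iff, Set.mem_singleton_iff, not_or] at hy01
    obtain ⟨i, hi⟩ := ne_true_iff.1 hy01.2
    have hle := le_unionAvoiding hy hi
    exact ⟨i, le_antisymm hle (hmax (hM i (h0 hy01.1 hle)) hle), hy01.1,
      fun j hj => hmax (hM j (h0 hy01.1 hj)) hj⟩
  · rintro ⟨i, rfl, hi0, hmax⟩
    refine ⟨hM i hi0, fun v hv hle => ?_⟩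
    obtain ⟨hv, hv01⟩ := hv
    simp only [Set.mem_insert_iff, Set.mem_singleton_iff, not_or] at hv01
    obtain ⟨j, hj⟩ := ne_true_iff.1 hv01.2
    have hvj := le_unionAvoiding hv hj
    exact hvj.trans (hmax j (hle.trans hvj))

end SetClosure

/-! ## The two reductions -/

namespace SetClosure

open EnumComplexity

/-! ### Both problems in terms of boolean vectors. -/

theorem charVector_le_iff {n : ℕ} {e T : Finset (Fin n)} :
    charVector e ≤ charVector T ↔ e ⊆ T := by
  simp [le_iff_imp, charVector, Finset.subset_iff]

/-- The support of a boolean vector. -/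
def support {n : ℕ} (u : Fin n → Bool) : Finset (Fin n) := Finset.univ.filter fun i => u i = true

theorem mem_support {n : ℕ} {u : Fin n → Bool} {i : Fin n} : i ∈ support u ↔ u i = true := by
  simp [support]

theorem charVector_support {n : ℕ} (u : Fin n → Bool) : charVector (support u) = u := by
  funext i
  simp [charVector, mem_support]

theorem support_charVector {n : ℕ} (e : Finset (Fin n)) : support (charVector e) = e := by
  ext i
  simp [charVector, mem_support]

/-- Independence in the hypergraph whose hyperedges are the supports of the vectors of `V`. -/
def Indep {n : ℕ} (V : Set (Fin n → Bool)) (T : Fin n → Bool) : Prop := ∀ u ∈ V, ¬ u ≤ T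

theorem maximal_isIndependent_iff {n : ℕ} {E : List (Finset (Fin n))} {T : Finset (Fin n)} :
    Maximal (IsIndependent {e | e ∈ E}) T ↔
      Maximal (Indep {u | u ∈ E.map charVector}) (charVector T) := by
  have key : ∀ T, IsIndependent {e | e ∈ E} T ↔
      Indep {u | u ∈ E.map charVector} (charVector T) := by
    intro T
    simp [IsIndependent, Indep, charVector_le_iff]
  refine and_congr (key T) ⟨fun h U hU hTU => ?_, fun h U hU hTU => ?_⟩
  · rw [← charVector_support U] at hU hTU ⊢
    exact charVector_le_iff.2 (h ((key _).2 hU) (charVector_le_iff.1 hTU))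
  · exact charVector_le_iff.1 (h ((key _).1 hU) (charVector_le_iff.2 hTU))

theorem mem_enumKMaxIndSet {k n : ℕ} {V : List (Fin n → Bool)} {y : Word} :
    y ∈ enumKMaxIndSet k (familyWord n V) ↔ (∀ u ∈ V, (support u).card ≤ k) ∧
      ∃ T, Maximal (Indep {u | u ∈ V}) T ∧ y = vectorWord T := by
  constructor
  · rintro ⟨n', E, T, hw, hE, hT, rfl⟩
    obtain ⟨rfl, rfl⟩ := familyWord_inj hw
    refine ⟨fun u hu => ?_, charVector T, maximal_isIndependent_iff.1 hT, rfl⟩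
    obtain ⟨e, he, rfl⟩ := List.mem_map.1 hu
    rw [support_charVector]
    exact hE e he
  · rintro ⟨hV, T, hT, rfl⟩
    have hm : (V.map support).map charVector = V := by
      rw [List.map_map]
      conv_rhs => rw [← List.map_id V]
      exact List.map_congr_left fun u _ => charVector_support u
    refine ⟨n, V.map support, support T, by rw [hm], ?_, ?_, by rw [charVector_support]⟩
    · intro e he
      obtain ⟨u, hu, rfl⟩ := List.mem_map.1 he
      exact hV u hu
    · rw [maximal_isIndependent_iff, hm, charVector_support]
      exact hT

theorem mem_enumClosureMax {F : Set (Op Bool)} {n : ℕ} {L : List (Fin n → Bool)} {y : Word} :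
    y ∈ enumClosureMax F (familyWord n L) ↔
      ∃ v ∈ maxElements (Cl F {u | u ∈ L} \ {fun _ => false, fun _ => true}), y = vectorWord v := by
  constructor
  · rintro ⟨n', L', v, hw, hv, rfl⟩
    obtain ⟨rfl, rfl⟩ := familyWord_inj hw
    exact ⟨v, hv, rfl⟩
  · rintro ⟨v, hv, rfl⟩
    exact ⟨n, L, v, rfl, hv, rfl⟩

theorem enumKMaxIndSet_eq_empty {k : ℕ} {w : Word}
    (h : ∀ (n : ℕ) (L : List (Fin n → Bool)), w ≠ familyWord n L) : enumKMaxIndSet k w = ∅ :=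
  Set.eq_empty_of_forall_notMem fun _ ⟨n, E, _, hw, _⟩ => h n (E.map charVector) hw

theorem enumClosureMax_eq_empty {F : Set (Op Bool)} {w : Word}
    (h : ∀ (n : ℕ) (L : List (Fin n → Bool)), w ≠ familyWord n L) : enumClosureMax F w = ∅ :=
  Set.eq_empty_of_forall_notMem fun _ ⟨n, L, _, hw, _⟩ => h n L hw

theorem nil_ne_familyWord (n : ℕ) (L : List (Fin n → Bool)) : [] ≠ familyWord n L := by
  simp [familyWord]

theorem onFamily_familyWord {β : Type} {r : ℕ → ℕ} (f : Word → ℕ → ℕ → List β) {n : ℕ}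
    (L : List (Fin n → Bool)) {y : Word} (hy : y.length = r n) :
    onFamily r f (familyWord n L ++ y) = f (familyWord n L ++ y) n L.length :=
  onFamily_eq f (hy ▸ startsWithFamily_familyWord L y)

theorem onFamily_zero_eq_nil {β : Type} (f : Word → ℕ → ℕ → List β) {w : Word}
    (h : ∀ (n : ℕ) (L : List (Fin n → Bool)), w ≠ familyWord n L) :
    onFamily (fun _ => 0) f w = [] :=
  onFamily_eq_nil f fun n _ hw => h n _ hw.eq_familyWord

/-- The number `i` is one of the `k` last digits of `t` in base `b`. -/
def IsDigit (b k t i : ℕ) : Prop := ∃ j : Fin k, t / b ^ j.val % b = i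

/-- Tuples are enumerated as numbers below `b ^ k`, so that a single loop of polynomial length
visits them all. -/
theorem exists_digits {b k : ℕ} (d : Fin k → Fin b) :
    ∃ t < b ^ k, ∀ j : Fin k, t / b ^ j.val % b = d j := by
  refine ⟨finFunctionFinEquiv d, (finFunctionFinEquiv d).isLt, fun j => ?_⟩
  conv_rhs => rw [← finFunctionFinEquiv.symm_apply_apply d]
  rfl

section Computability

variable {α : Type} [Ctx α]

theorem comp_digit {b t : Word → α → ℕ} (hb : Comp b) (ht : Comp t) (j : ℕ) :
    Comp (fun w a => t w a / b w a ^ j % b w a) := (ht.div (hb.pow j)).mod hb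

theorem decid_isDigit (k : ℕ) {b t i : Word → α → ℕ} (hb : Comp b) (ht : Comp t) (hi : Comp i) :
    Decid (fun w a => IsDigit (b w a) k (t w a) (i w a)) :=
  .exists_fin fun j => .eq (comp_digit hb ht j) hi

end Computability

/-! ### From closures to hypergraphs -/

/-- The `k` digits of `t` in base `n` do not all belong to the support of one of the vectors. -/
def Uncovered (k : ℕ) (w : Word) (n m t : ℕ) : Prop :=
  ∀ j < m, ∃ i : Fin k, ¬ entry w n j (t / n ^ i.val % n)

/-- The hypergraph of the sets of at most `k` coordinates that are not contained in the support
of any of the given vectors. -/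
noncomputable def uncoveredHypergraph (k : ℕ) : Word → Word :=
  onFamily (fun _ => 0) fun w n m =>
    familyWord n (selection n (n ^ k) (Uncovered k w n m) (IsDigit n k))

theorem polyTime_uncoveredHypergraph (k : ℕ) : PolyTime (uncoveredHypergraph k) :=
  .of_genWord <| .onFamily (fun _ => .const 0) fun hn hm =>
    .familyWord hn (hn.pow k)
      (.forall_lt hm.weaken (.exists_fin fun i =>
        .not (.entry hn.weaken.weaken .var (comp_digit hn.weaken.weaken (.weaken .var) i))))
      (decid_isDigit k hn.weaken.weaken.weaken (.weaken (.weaken .var)) .var)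

theorem uncoveredHypergraph_familyWord {k n : ℕ} (L : List (Fin n → Bool)) :
    ∃ V : List (Fin n → Bool), uncoveredHypergraph k (familyWord n L) = familyWord n V ∧
      ∀ u, u ∈ V ↔ ∃ d : Fin k → Fin n, (∀ s ∈ L, ∃ i, s (d i) = false) ∧
        ∀ l, u l = true ↔ ∃ i, d i = l := by
  refine ⟨selection n (n ^ k) (Uncovered k (familyWord n L ++ []) n L.length) (IsDigit n k), ?_,
    fun u => ?_⟩
  · rw [← onFamily_familyWord (r := fun _ => 0) (fun w n m => familyWord n
      (selection n (n ^ k) (Uncovered k w n m) (IsDigit n k))) L (y := []) rfl, List.append_nil]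
    rfl
  have hU : ∀ (t : ℕ) (d : Fin k → Fin n), (∀ j, t / n ^ j.val % n = d j) →
      (Uncovered k (familyWord n L ++ []) n L.length t ↔ ∀ s ∈ L, ∃ i, s (d i) = false) := by
    intro t d hd
    rw [List.forall_mem_iff_forall_getElem]
    refine forall_congr' fun j => forall_congr' fun hj => exists_congr fun i => ?_
    rw [hd, entry_familyWord L [] hj, Bool.not_eq_true]
  have hD : ∀ (t : ℕ) (d : Fin k → Fin n), (∀ j, t / n ^ j.val % n = d j) →
      ∀ l : Fin n, IsDigit n k t l ↔ ∃ i, d i = l := by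
    intro t d hd l
    exact exists_congr fun i => by rw [hd, Fin.ext_iff]
  rw [mem_selection]
  constructor
  · rintro ⟨t, ht, hu, hul⟩
    -- Digits in base `n` are coordinates only if `n` is positive; for `n = 0` and `k` positive no
    -- `t` lies below `n ^ k`.
    have hn : Fin k → 0 < n := by
      intro i
      by_contra h0
      obtain rfl : n = 0 := by omega
      rw [Nat.zero_pow (Fin.pos i)] at ht
      omega
    let d : Fin k → Fin n := fun i => ⟨t / n ^ i.val % n, Nat.mod_lt _ (hn i)⟩
    exact ⟨d, (hU t d fun _ => rfl).1 hu, fun l => (hul l).trans (hD t d (fun _ => rfl) l)⟩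
  · rintro ⟨d, hd, hul⟩
    obtain ⟨t, ht, htd⟩ := exists_digits d
    exact ⟨t, ht, (hU t d htd).2 hd, fun l => (hul l).trans (hD t d htd l).symm⟩

/-- The hyperedges are the ranges of the uncovered tuples, so containing no hyperedge means that
every tuple inside `T` is covered. -/
theorem indep_iff_covered {k n : ℕ} {S V : Set (Fin n → Bool)}
    (hV : ∀ u, u ∈ V ↔ ∃ d : Fin k → Fin n, (∀ s ∈ S, ∃ i, s (d i) = false) ∧
        ∀ l, u l = true ↔ ∃ i, d i = l) {T : Fin n → Bool} : Indep V T ↔ Covered k S T := by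
  constructor
  · intro h d hd
    by_contra! hs
    refine h (fun l => decide (∃ i, d i = l)) ((hV _).2 ⟨d, fun s hsS => ?_, by simp⟩) ?_
    · obtain ⟨j, hj⟩ := hs s hsS
      exact ⟨j, Bool.eq_false_of_not_eq_true hj⟩
    · refine le_iff_imp.2 fun l hl => ?_
      obtain ⟨i, rfl⟩ := of_decide_eq_true hl
      exact hd i
  · intro h u hu huT
    obtain ⟨d, hd, hul⟩ := (hV u).1 hu
    obtain ⟨s, hs, hsd⟩ := h d fun j => le_iff_imp.1 huT _ ((hul _).2 ⟨j, rfl⟩)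
    obtain ⟨i, hi⟩ := hd s hs
    simp [hsd i] at hi

theorem mem_enumKMaxIndSet_uncoveredHypergraph {k n : ℕ} {L : List (Fin n → Bool)} {y : Word} :
    y ∈ enumKMaxIndSet k (uncoveredHypergraph k (familyWord n L)) ↔
      ∃ T, Maximal (Covered k {u | u ∈ L}) T ∧ y = vectorWord T := by
  obtain ⟨V, hV, hmem⟩ := uncoveredHypergraph_familyWord (k := k) L
  have hI : Indep {u | u ∈ V} = Covered k {u | u ∈ L} :=
    funext fun T => propext (indep_iff_covered (S := {u | u ∈ L}) (V := {u | u ∈ V}) hmem)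
  rw [hV, mem_enumKMaxIndSet, hI, and_iff_right]
  intro u hu
  obtain ⟨d, -, hul⟩ := (hmem u).1 hu
  have : support u = Finset.univ.image d := by
    ext l
    rw [mem_support, hul]
    simp
  rw [this]
  exact Finset.card_image_le.trans (by simp)

/-- One of the vectors vanishes at `i` but not at `l`. -/
def Separated (w : Word) (n m i l : ℕ) : Prop := ∃ j < m, ¬ entry w n j i ∧ entry w n j l

/-- The coordinate `i` is the first one to which a certain maximal vector belongs, in the case
where the vector `(1, …, 1)` belongs to the closure. -/
def IsRepresentative (w : Word) (n m i : ℕ) : Prop :=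
  (∃ l < n, Separated w n m i l) ∧
  (∀ j < n, (∀ l < n, Separated w n m i l → Separated w n m j l) →
    ∀ l < n, Separated w n m j l → Separated w n m i l) ∧
  ∀ j < i, ∃ l < n, ¬ (Separated w n m j l ↔ Separated w n m i l)

/-- The entry number `i` of the vector that follows the family. -/
def suffixEntry (w : Word) (n m i : ℕ) : Prop := letterAt w ((m + 1) * (n + 1) + i) = 1

open scoped Classical in
/-- The solutions that correspond to a maximal independent set, given by its characteristic vector
which follows the family. -/
noncomputable def closureSolutions : Word → List Word :=
  onFamily (fun n => n) fun w n m =>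
    -- The all-ones set signals that the maximal unions are to be listed, any other nonempty set
    -- stands for itself, and the empty set gives nothing.
    (if (∃ i < n, suffixEntry w n m i) ∧ ∀ i < n, suffixEntry w n m i then
      (selection n n (IsRepresentative w n m) (Separated w n m)).map vectorWord else []) ++
    (if (∃ i < n, suffixEntry w n m i) ∧ ¬ ∀ i < n, suffixEntry w n m i then
      [vectorWord (fun i : Fin n => decide (suffixEntry w n m i))] else [])

section Computability

variable {α : Type} [Ctx α]

theorem decid_separated {n m i l : Word → α → ℕ} (hn : Comp n) (hm : Comp m) (hi : Comp i)
    (hl : Comp l) : Decid (fun w a => Separated w (n w a) (m w a) (i w a) (l w a)) :=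
  .exists_lt hm (.and (.not (.entry hn.weaken .var hi.weaken)) (.entry hn.weaken .var hl.weaken))

theorem decid_isRepresentative {n m i : Word → α → ℕ} (hn : Comp n) (hm : Comp m) (hi : Comp i) :
    Decid (fun w a => IsRepresentative w (n w a) (m w a) (i w a)) :=
  .and (.exists_lt hn (decid_separated hn.weaken hm.weaken hi.weaken .var))
    (.and
      (.forall_lt hn (.imp
        (.forall_lt hn.weaken (.imp
          (decid_separated hn.weaken.weaken hm.weaken.weaken hi.weaken.weaken .var)
          (decid_separated hn.weaken.weaken hm.weaken.weaken (.weaken .var) .var)))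
        (.forall_lt hn.weaken (.imp
          (decid_separated hn.weaken.weaken hm.weaken.weaken (.weaken .var) .var)
          (decid_separated hn.weaken.weaken hm.weaken.weaken hi.weaken.weaken .var)))))
      (.forall_lt hi (.exists_lt hn.weaken (.not (.iff
        (decid_separated hn.weaken.weaken hm.weaken.weaken (.weaken .var) .var)
        (decid_separated hn.weaken.weaken hm.weaken.weaken hi.weaken.weaken .var))))))

theorem decid_suffixEntry {n m i : Word → α → ℕ} (hn : Comp n) (hm : Comp m) (hi : Comp i) :
    Decid (fun w a => suffixEntry w (n w a) (m w a) (i w a)) :=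
  .eq (.letterAt (.add (.mul (.add hm (.const 1)) (.add hn (.const 1))) hi)) (.const 1)

theorem genList_selection {n N : Word → α → ℕ} (hn : Comp n) (hN : Comp N)
    {p : Word → α → ℕ → Prop} (hp : Decid (fun (w : Word) (a : α × ℕ) => p w a.1 a.2))
    {v : Word → α → ℕ → ℕ → Prop}
    (hv : Decid (fun (w : Word) (a : ((α × ℕ) × ℕ) × ℕ) => v w a.1.1.1 a.1.1.2 a.2)) :
    GenList (fun w a => (selection (n w a) (N w a) (p w a) (v w a)).map vectorWord) := by
  classical
  simp only [List.map_eq_flatMap, flatMap_selection]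
  exact .flatMap_range (u := fun w a t => if p w a t then
    [vectorWord (fun i : Fin (n w a) => decide (v w a t i))] else []) hN
    (.ite hp (.singleton (.vectorWord hn.weaken.weaken hv)))

end Computability

theorem genList_closureSolutions : GenList (fun w (_ : Unit) => closureSolutions w) := by
  refine .onFamily (fun hn => hn) fun {β} _ {n m} hn hm => ?_
  have he : Decid (fun w b => ∃ i < n w b, suffixEntry w (n w b) (m w b) i) :=
    .exists_lt hn (decid_suffixEntry hn.weaken hm.weaken .var)
  have ha : Decid (fun w b => ∀ i < n w b, suffixEntry w (n w b) (m w b) i) :=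
    .forall_lt hn (decid_suffixEntry hn.weaken hm.weaken .var)
  exact .append
    (.ite (he.and ha) (genList_selection hn.weaken hn.weaken
      (decid_isRepresentative hn.weaken.weaken hm.weaken.weaken .var)
      (decid_separated hn.weaken.weaken.weaken.weaken hm.weaken.weaken.weaken.weaken
        (.weaken (.weaken .var)) .var)))
    (.ite (he.and ha.not) (.singleton (.vectorWord hn.weaken
      (decid_suffixEntry hn.weaken.weaken hm.weaken.weaken .var))))

theorem nodup_selection_isRepresentative (w : Word) (n m : ℕ) :
    (selection n n (IsRepresentative w n m) (Separated w n m)).Nodup := by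
  classical
  refine List.Nodup.map_on ?_ (List.nodup_range.filter _)
  have key : ∀ i j, i < j → IsRepresentative w n m j →
      (fun l : Fin n => decide (Separated w n m i l)) ≠ fun l : Fin n => decide (Separated w n m j l) := by
    intro i j hij hj h
    obtain ⟨l, hl, hne⟩ := hj.2.2 i hij
    exact hne (by simpa using congrFun h ⟨l, hl⟩)
  intro i hi j hj h
  simp only [List.mem_filter, decide_eq_true_eq] at hi hj
  rcases lt_trichotomy i j with hij | hij | hij
  · exact absurd h (key i j hij hj.2)
  · exact hij
  · exact absurd h.symm (key j i hij hi.2)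

theorem nodup_closureSolutions (w : Word) : (closureSolutions w).Nodup := by
  by_cases h : ∃ n m, StartsWithFamily w n m n
  · obtain ⟨n, m, h⟩ := h
    rw [closureSolutions, onFamily_eq (r := fun n => n) _ h]
    have := (nodup_selection_isRepresentative w n m).map vectorWord_injective
    split_ifs with h1 h2 h2
    · exact absurd h1.2 h2.2
    · rwa [List.append_nil]
    · simp
    · simp
  · push Not at h
    rw [closureSolutions, onFamily_eq_nil (r := fun n => n) _ h]
    exact List.nodup_nil

theorem separated_familyWord {n : ℕ} {L : List (Fin n → Bool)} {y : Word} {i l : Fin n} :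
    Separated (familyWord n L ++ y) n L.length i l ↔
      unionAvoiding {u | u ∈ L} i l = true := by
  rw [unionAvoiding_eq_true]
  constructor
  · rintro ⟨j, hj, hi, hl⟩
    rw [entry_familyWord L y hj] at hi hl
    exact ⟨L[j], List.getElem_mem hj, Bool.eq_false_of_not_eq_true hi, hl⟩
  · rintro ⟨s, hs, hi, hl⟩
    obtain ⟨j, hj, rfl⟩ := List.getElem_of_mem hs
    refine ⟨j, hj, ?_, ?_⟩ <;> rw [entry_familyWord L y hj]
    · simp [hi]
    · exact hl

theorem suffixEntry_familyWord {n : ℕ} {L : List (Fin n → Bool)} {T : Fin n → Bool} (i : Fin n) :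
    suffixEntry (familyWord n L ++ vectorWord T) n L.length i ↔ T i = true := by
  rw [suffixEntry, letterAt_familyWord_append, letterAt_vectorWord T i.isLt]
  cases T i <;> simp

theorem mem_selection_isRepresentative {n : ℕ} {L : List (Fin n → Bool)} {y : Word}
    {v : Fin n → Bool} :
    v ∈ selection n n (IsRepresentative (familyWord n L ++ y) n L.length)
        (Separated (familyWord n L ++ y) n L.length) ↔
      ∃ i, v = unionAvoiding {u | u ∈ L} i ∧ v ≠ (fun _ => false) ∧
        ∀ j, v ≤ unionAvoiding {u | u ∈ L} j → unionAvoiding {u | u ∈ L} j ≤ v := by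
  set M := unionAvoiding {u | u ∈ L} with hM
  have hrep : ∀ i : Fin n, IsRepresentative (familyWord n L ++ y) n L.length i ↔
      M i ≠ (fun _ => false) ∧ (∀ j, M i ≤ M j → M j ≤ M i) ∧ ∀ j < i, M j ≠ M i := by
    intro i
    refine and_congr ?_ (and_congr ?_ ?_)
    · rw [ne_false_iff, Fin.exists_iff]
      refine exists_congr fun l => ⟨fun ⟨hl, h⟩ => ⟨hl, ?_⟩, fun ⟨hl, h⟩ => ⟨hl, ?_⟩⟩
      · exact (separated_familyWord (i := i) (l := ⟨l, hl⟩)).1 h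
      · exact (separated_familyWord (i := i) (l := ⟨l, hl⟩)).2 h
    · have hle : ∀ i j : Fin n, (∀ l < n, Separated (familyWord n L ++ y) n L.length i l →
          Separated (familyWord n L ++ y) n L.length j l) ↔ M i ≤ M j := by
        intro i j
        rw [le_iff_imp, Fin.forall_iff]
        refine forall_congr' fun l => forall_congr' fun hl => ?_
        exact imp_congr (separated_familyWord (l := ⟨l, hl⟩)) (separated_familyWord (l := ⟨l, hl⟩))
      rw [Fin.forall_iff]
      refine forall_congr' fun j => forall_congr' fun hj => ?_
      exact imp_congr (hle i ⟨j, hj⟩) (hle ⟨j, hj⟩ i)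
    · constructor
      · intro h j hj hji
        obtain ⟨l, hl, hne⟩ := h j hj
        refine hne ?_
        have h1 := separated_familyWord (L := L) (y := y) (i := j) (l := ⟨l, hl⟩)
        have h2 := separated_familyWord (L := L) (y := y) (i := i) (l := ⟨l, hl⟩)
        rw [← hM, hji] at h1
        exact h1.trans h2.symm
      · intro h j hj
        have hjn : j < n := hj.trans i.isLt
        have hne := h ⟨j, hjn⟩ hj
        by_contra! hall
        refine hne (funext fun l => ?_)
        rw [Bool.eq_iff_iff]
        exact separated_familyWord.symm.trans ((hall l l.isLt).trans separated_familyWord)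
  rw [mem_selection]
  constructor
  · rintro ⟨t, ht, hrt, hv⟩
    have hvt : v = M ⟨t, ht⟩ := funext fun l => Bool.eq_iff_iff.2
      ((hv l).trans (separated_familyWord (i := ⟨t, ht⟩)))
    have h := (hrep ⟨t, ht⟩).1 hrt
    exact ⟨⟨t, ht⟩, hvt, hvt ▸ h.1, hvt ▸ h.2.1⟩
  · rintro ⟨i, rfl, h0, hmax⟩
    -- Different coordinates may give the same union; the least of them is the representative, which
    -- prevents repeated output.
    obtain ⟨i', hi', hmin⟩ := WellFounded.has_min (wellFounded_lt (α := Fin n)) {j | M j = M i}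
      ⟨i, rfl⟩
    have hi' : M i' = M i := hi'
    refine ⟨i', i'.isLt, (hrep i').2 ⟨hi' ▸ h0, hi' ▸ hmax, fun j hj h => ?_⟩, fun l => ?_⟩
    · exact hmin j (h.trans hi') hj
    · rw [separated_familyWord, ← hM, hi']

theorem mem_closureSolutions {n : ℕ} {L : List (Fin n → Bool)} {T : Fin n → Bool} {z : Word} :
    z ∈ closureSolutions (familyWord n L ++ vectorWord T) ↔ T ≠ (fun _ => false) ∧
      ((T = (fun _ => true) ∧ ∃ v, (∃ i, v = unionAvoiding {u | u ∈ L} i ∧ v ≠ (fun _ => false) ∧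
        ∀ j, v ≤ unionAvoiding {u | u ∈ L} j → unionAvoiding {u | u ∈ L} j ≤ v) ∧
        z = vectorWord v) ∨ (T ≠ (fun _ => true) ∧ z = vectorWord T)) := by
  have he : (∃ i < n, suffixEntry (familyWord n L ++ vectorWord T) n L.length i) ↔
      T ≠ fun _ => false := by
    rw [ne_false_iff, Fin.exists_iff]
    refine exists_congr fun i => ⟨fun ⟨hi, h⟩ => ⟨hi, ?_⟩, fun ⟨hi, h⟩ => ⟨hi, ?_⟩⟩
    · exact (suffixEntry_familyWord ⟨i, hi⟩).1 h
    · exact (suffixEntry_familyWord ⟨i, hi⟩).2 h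
  have ha : (∀ i < n, suffixEntry (familyWord n L ++ vectorWord T) n L.length i) ↔
      T = fun _ => true := by
    rw [funext_iff, Fin.forall_iff]
    exact forall_congr' fun i => forall_congr' fun hi => suffixEntry_familyWord ⟨i, hi⟩
  have hT : (fun i : Fin n => open scoped Classical in
      decide (suffixEntry (familyWord n L ++ vectorWord T) n L.length i)) = T := by
    funext i
    classical
    rw [Bool.eq_iff_iff, decide_eq_true_iff, suffixEntry_familyWord]
  rw [closureSolutions, onFamily_familyWord (r := fun n => n) _ L (length_vectorWord T)]
  simp only [he, ha, hT, List.mem_append]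
  by_cases h0 : T = fun _ => false
  · simp [h0]
  · by_cases h1 : T = fun _ => true
    · rw [if_pos ⟨h0, h1⟩, if_neg fun h => h.2 h1]
      rw [and_iff_right h0, and_iff_right h1, or_iff_left List.not_mem_nil,
        or_iff_left fun h => h.1 h1]
      simp only [List.mem_map, mem_selection_isRepresentative]
      exact exists_congr fun v => and_congr_right fun _ => eq_comm
    · simp [h0, h1]

theorem closureMax_reducible_kMaxIndSet {k : ℕ} (hk : 2 ≤ k) :
    PolyDelayReducible (enumClosureMax (S10 k)) (enumKMaxIndSet k) := by
  refine ⟨uncoveredHypergraph k, fun w => {y | y ∈ closureSolutions w},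
    polyTime_uncoveredHypergraph k, .of_gen nodup_closureSolutions genList_closureSolutions,
    fun x => ?_⟩
  by_cases hx : ∃ (n : ℕ) (L : List (Fin n → Bool)), x = familyWord n L
  · obtain ⟨n, L, rfl⟩ := hx
    by_cases h1 : Covered k {u | u ∈ L} fun _ => true
    -- Everything is independent here, so the whole vertex set is the only solution of the
    -- hypergraph problem and carries all the solutions of the closure problem.
    · have hmax : ∀ T, Maximal (Covered k {u | u ∈ L}) T ↔ T = fun _ => true := by
        intro T
        refine ⟨fun hT => le_antisymm (fun _ => Bool.le_true _) (hT.2 h1 fun _ => Bool.le_true _),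
          ?_⟩
        rintro rfl
        exact ⟨h1, fun _ _ _ _ => Bool.le_true _⟩
      have hB : ∀ y, y ∈ enumKMaxIndSet k (uncoveredHypergraph k (familyWord n L)) ↔
          y = vectorWord (n := n) fun _ => true := by
        intro y
        rw [mem_enumKMaxIndSet_uncoveredHypergraph]
        simp [hmax]
      refine ⟨fun y hy z hz hne => absurd (((hB y).1 hy).trans ((hB z).1 hz).symm) hne, ?_⟩
      ext z
      simp only [hB, Set.mem_iUnion, Set.mem_ofPred_eq, exists_prop, exists_eq_left,
        ne_eq, not_true, false_and, or_false, true_and,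
        mem_closureSolutions, mem_enumClosureMax, mem_maxElements_of_covered hk h1]
      constructor
      · rintro ⟨v, ⟨i, hi, hv0, hv⟩, rfl⟩
        refine ⟨ne_false_iff.2 ⟨i, rfl⟩, ⟨v, ⟨i, hi, hv0, hv⟩, rfl⟩⟩
      · rintro ⟨-, h⟩
        exact h
    · have hT1 : ∀ T, Maximal (Covered k {u | u ∈ L}) T → T ≠ fun _ => true := by
        rintro T hT rfl
        exact h1 hT.1
      constructor
      · intro y hy z hz hne
        rw [mem_enumKMaxIndSet_uncoveredHypergraph] at hy hz
        obtain ⟨T, hT, rfl⟩ := hy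
        obtain ⟨U, hU, rfl⟩ := hz
        refine Set.eq_empty_of_forall_notMem fun u ⟨h, h'⟩ => hne ?_
        have h := mem_closureSolutions.1 h
        have h' := mem_closureSolutions.1 h'
        -- Neither set is all-ones, so each yields at most itself; a common output would make them
        -- equal.
        simp only [hT1 T hT, hT1 U hU, false_and, false_or] at h h'
        rw [← h.2.2, ← h'.2.2]
      · ext z
        simp only [Set.mem_iUnion, exists_prop, mem_enumKMaxIndSet_uncoveredHypergraph,
          mem_enumClosureMax, mem_maxElements_of_not_covered hk h1]
        constructor
        · rintro ⟨v, ⟨h0, hv⟩, rfl⟩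
          exact ⟨_, ⟨v, hv, rfl⟩, mem_closureSolutions.2 ⟨h0, .inr ⟨hT1 v hv, rfl⟩⟩⟩
        · rintro ⟨_, ⟨T, hT, rfl⟩, h⟩
          obtain ⟨h0, ⟨h, -⟩ | ⟨-, rfl⟩⟩ := mem_closureSolutions.1 h
          · exact absurd h (hT1 T hT)
          · exact ⟨T, ⟨h0, hT⟩, rfl⟩
  · push Not at hx
    have hf : uncoveredHypergraph k x = [] := onFamily_zero_eq_nil _ hx
    rw [hf, enumKMaxIndSet_eq_empty nil_ne_familyWord, enumClosureMax_eq_empty hx]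
    simp

end SetClosure

namespace SetClosure

open EnumComplexity

/-! ### From hypergraphs to closures -/

/-! ### The two additional coordinates and the family of small independent sets. -/

section Extension

variable {n k : ℕ}

/-- The vector `T` with two more entries, one and zero. -/
def extend (T : Fin n → Bool) : Fin (n + 2) → Bool :=
  fun l => if h : l.val < n then T ⟨l, h⟩ else decide (l.val = n)

theorem extend_castAdd (T : Fin n → Bool) (i : Fin n) : extend T (i.castAdd 2) = T i := by
  simp [extend]

theorem extend_le_extend_iff {T U : Fin n → Bool} : extend T ≤ extend U ↔ T ≤ U := by
  constructor
  · intro h i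
    rw [← extend_castAdd T, ← extend_castAdd U]
    exact h _
  · intro h l
    unfold extend
    split_ifs
    · exact h _
    · exact le_rfl

/-- The entry that is always one saves even the empty independent set from being discarded as the
zero vector. -/
theorem extend_ne_false (T : Fin n → Bool) : extend T ≠ fun _ => false :=
  ne_false_iff.2 ⟨⟨n, by omega⟩, by simp [extend]⟩

/-- The entry that is always zero saves the full vertex set from being discarded as the all-ones
vector. -/
theorem extend_last (T : Fin n → Bool) : extend T (Fin.last (n + 1)) = false := by
  simp [extend]

/-- The independent sets of size at most `k`, given by tuples, with two more entries. -/
def IsTupleFamily (k : ℕ) (L : Set (Fin n → Bool)) (S : Set (Fin (n + 2) → Bool)) : Prop :=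
  ∀ u, u ∈ S ↔ ∃ d : Fin k → Fin (n + 1), (∀ s ∈ L, ∃ i, s i = true ∧ ∀ j, d j ≠ i.castSucc) ∧
    ∀ l, u l = true ↔ l.val = n ∨ ∃ j, (d j).val = l.val

variable {L : Set (Fin n → Bool)} {S : Set (Fin (n + 2) → Bool)}

/-- A tuple inside `extend T` avoids the last coordinate and is covered by the vector that it
defines itself: each hyperedge has a vertex outside `T`, hence outside the tuple. -/
theorem IsTupleFamily.covered_extend (hS : IsTupleFamily k L S) {T : Fin n → Bool}
    (hT : Indep L T) : Covered k S (extend T) := by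
  intro d hd
  have hlt : ∀ j, (d j).val < n + 1 := by
    intro j
    have h := hd j
    by_contra hj
    have h1 : ¬ (d j).val < n := by omega
    have h2 : ¬ (d j).val = n := by omega
    simp [extend, h1, h2] at h
  refine ⟨fun l => decide (l.val = n ∨ ∃ j, (d j).val = l.val), (hS _).2
    ⟨fun j => ⟨d j, hlt j⟩, fun s hs => ?_, fun l => by simp⟩, fun j => by simp⟩
  have h := hT s hs
  rw [le_iff_imp] at h
  push Not at h
  obtain ⟨i, hi, hTi⟩ := h
  refine ⟨i, hi, fun j hj => hTi ?_⟩
  rw [← extend_castAdd T, ← hd j]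
  congr 1
  exact Fin.ext (congrArg Fin.val hj).symm

/-- A hyperedge inside `U` has at most `k` vertices, so it fits into one tuple; the vector of `S`
covering this tuple would contain the hyperedge, although it comes from an independent set. -/
theorem IsTupleFamily.indep_of_covered (hS : IsTupleFamily k L S)
    (hL : ∀ s ∈ L, (support s).card ≤ k) {U : Fin (n + 2) → Bool} (hU : Covered k S U)
    (h0 : U ≠ fun _ => false) : Indep L fun i => U (i.castAdd 2) := by
  intro s hs hle
  obtain ⟨d, hdU, hds⟩ : ∃ d : Fin k → Fin (n + 2), (∀ j, U (d j) = true) ∧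
      ∀ i, s i = true → ∃ j, d j = i.castAdd 2 := by
    rcases (support s).eq_empty_or_nonempty with he | he
    · obtain ⟨l, hl⟩ := ne_false_iff.1 h0
      -- For an empty hyperedge any tuple inside `U` serves; a constant one exists because `U` is
      -- nonzero.
      refine ⟨fun _ => l, fun _ => hl, fun i hi => ?_⟩
      rw [← mem_support, he] at hi
      exact absurd hi (Finset.notMem_empty i)
    · obtain ⟨d, hd⟩ := exists_tuple he (hL s hs)
      refine ⟨fun j => (d j).castAdd 2, fun j => ?_, fun i hi => ?_⟩
      · exact le_iff_imp.1 hle _ (mem_support.1 ((hd _).2 ⟨j, rfl⟩))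
      · obtain ⟨j, rfl⟩ := (hd i).1 (mem_support.2 hi)
        exact ⟨j, rfl⟩
  obtain ⟨u, hu, hud⟩ := hU d hdU
  obtain ⟨e, he, hul⟩ := (hS u).1 hu
  obtain ⟨i, hi, hie⟩ := he s hs
  obtain ⟨j, hj⟩ := hds i hi
  rcases (hul _).1 (hud j) with h | ⟨j', h⟩
  · rw [hj, Fin.val_castAdd] at h
    exact absurd h i.isLt.ne
  · rw [hj, Fin.val_castAdd] at h
    exact hie j' (Fin.ext h)

/-- All vectors of `S` vanish at the last coordinate; testing `U` on a constant tuple shows that `U`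
does too. -/
theorem IsTupleFamily.le_extend (hS : IsTupleFamily k L S) (hk : 2 ≤ k) {U : Fin (n + 2) → Bool}
    (hU : Covered k S U) : U ≤ extend fun i => U (i.castAdd 2) := by
  refine le_iff_imp.2 fun l hl => ?_
  unfold extend
  split_ifs with h
  · exact hl
  · refine decide_eq_true ?_
    obtain ⟨u, hu, hul⟩ := hU (fun _ => l) fun _ => hl
    obtain ⟨d, -, hd⟩ := (hS u).1 hu
    rcases (hd l).1 (hul ⟨0, by omega⟩) with h1 | ⟨j, hj⟩
    · exact h1
    · have := (d j).isLt
      omega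

/-- Restricting a nonzero covered vector gives an independent set whose extension is covered and
lies above it, so maximal covered vectors are extensions, and `extend` preserves and reflects the
order. -/
theorem IsTupleFamily.mem_maxElements (hS : IsTupleFamily k L S) (hk : 2 ≤ k)
    (hL : ∀ s ∈ L, (support s).card ≤ k) {v : Fin (n + 2) → Bool} :
    v ∈ maxElements (Cl (S10 k) S \ {fun _ => false, fun _ => true}) ↔
      ∃ T, Maximal (Indep L) T ∧ v = extend T := by
  have h1 : ¬ Covered k S fun _ => true := by
    intro h
    have := le_iff_imp.1 (hS.le_extend hk h) (Fin.last (n + 1)) rfl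
    rw [extend_last] at this
    exact Bool.noConfusion this
  rw [mem_maxElements_of_not_covered hk h1]
  constructor
  · rintro ⟨h0, hv, hmax⟩
    have hI := hS.indep_of_covered hL hv h0
    have hle := hS.le_extend hk hv
    have heq := le_antisymm hle (hmax (hS.covered_extend hI) hle)
    refine ⟨_, ⟨hI, fun T hT hle' => ?_⟩, heq⟩
    rw [← extend_le_extend_iff, ← heq] at hle' ⊢
    exact hmax (hS.covered_extend hT) hle'
  · rintro ⟨T, ⟨hT, hmax⟩, rfl⟩
    refine ⟨extend_ne_false T, hS.covered_extend hT, fun U hU hle => ?_⟩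
    have h0 : U ≠ fun _ => false := by
      obtain ⟨i, hi⟩ := ne_false_iff.1 (extend_ne_false T)
      exact ne_false_iff.2 ⟨i, le_iff_imp.1 hle i hi⟩
    refine (hS.le_extend hk hU).trans (extend_le_extend_iff.2 ?_)
    refine hmax (hS.indep_of_covered hL hU h0) fun i => ?_
    rw [← extend_castAdd T]
    exact hle _

end Extension

/-- The set number `t` of at most `k` vertices is independent. -/
def TupleIndep (k : ℕ) (w : Word) (n m t : ℕ) : Prop :=
  ∀ j < m, ∃ i < n, entry w n j i ∧ ¬ IsDigit (n + 1) k t i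

open scoped Classical in
/-- The vectors of the independent sets of at most `k` elements, with two more entries. -/
noncomputable def tupleFamily (k : ℕ) : Word → Word :=
  onFamily (fun _ => 0) fun w n m =>
    -- A hypergraph with a hyperedge of more than `k` elements has no solutions by convention; it is
    -- sent to the empty word, which encodes no family.
    if ∀ j < m, (∑ i ∈ Finset.range n, if entry w n j i then 1 else 0) ≤ k then
      -- In base `n + 1` the digit `n` names the coordinate that is always one. It serves as
      -- padding, so that the tuples also describe the empty set.
      familyWord (n + 2) (selection (n + 2) ((n + 1) ^ k) (TupleIndep k w n m)
        (fun t l => l = n ∨ IsDigit (n + 1) k t l)) else []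

theorem polyTime_tupleFamily (k : ℕ) : PolyTime (tupleFamily k) := by
  classical
  refine .of_genWord <| .onFamily (fun _ => .const 0) fun {β} _ {n m} hn hm => ?_
  have hn1 := hn.weaken.add (.const 1)
  refine .ite (.forall_lt hm (.le (.sum hn.weaken (Decid.comp
    (.entry hn.weaken.weaken (.weaken .var) .var))) (.const k))) ?_
  refine .familyWord (.add hn.weaken (.const 2)) (hn1.pow k) ?_ ?_
  · exact .forall_lt hm.weaken.weaken (.exists_lt hn.weaken.weaken.weaken
      (.and (.entry hn.weaken.weaken.weaken.weaken (.weaken .var) .var)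
        (.not (decid_isDigit k hn1.weaken.weaken.weaken (.weaken (.weaken .var)) .var))))
  · exact .or (.eq .var hn.weaken.weaken.weaken.weaken)
      (decid_isDigit k hn1.weaken.weaken.weaken (.weaken (.weaken .var)) .var)

theorem sum_entry_eq_card {n j : ℕ} {L : List (Fin n → Bool)} {y : Word} (hj : j < L.length)
    {_ : ∀ i, Decidable (entry (familyWord n L ++ y) n j i)} :
    (∑ i ∈ Finset.range n, if entry (familyWord n L ++ y) n j i then 1 else 0) =
      (support L[j]).card := by
  rw [Finset.sum_range, support, Finset.card_filter]
  refine Finset.sum_congr rfl fun i _ => ?_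
  simp only [entry_familyWord L y hj i]

theorem tupleFamily_familyWord_of_not {k n : ℕ} {L : List (Fin n → Bool)}
    (h : ¬ ∀ s ∈ L, (support s).card ≤ k) : tupleFamily k (familyWord n L) = [] := by
  rw [← List.append_nil (familyWord n L), tupleFamily,
    onFamily_familyWord (r := fun _ => 0) _ L (y := []) rfl, if_neg]
  rw [List.forall_mem_iff_forall_getElem] at h
  refine fun h' => h fun j hj => ?_
  rw [← sum_entry_eq_card hj]
  exact h' j hj

theorem tupleFamily_familyWord {k n : ℕ} {L : List (Fin n → Bool)}
    (h : ∀ s ∈ L, (support s).card ≤ k) :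
    ∃ V : List (Fin (n + 2) → Bool), tupleFamily k (familyWord n L) = familyWord (n + 2) V ∧
      IsTupleFamily k {u | u ∈ L} {u | u ∈ V} := by
  refine ⟨selection (n + 2) ((n + 1) ^ k) (TupleIndep k (familyWord n L ++ []) n L.length)
        (fun t l => l = n ∨ IsDigit (n + 1) k t l), ?_, fun u => ?_⟩
  · conv_lhs => rw [← List.append_nil (familyWord n L)]
    rw [tupleFamily, onFamily_familyWord (r := fun _ => 0) _ L (y := []) rfl, if_pos]
    rw [List.forall_mem_iff_forall_getElem] at h
    intro j hj
    rw [sum_entry_eq_card hj]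
    exact h j hj
  have hD : ∀ (t : ℕ) (d : Fin k → Fin (n + 1)), (∀ j, t / (n + 1) ^ j.val % (n + 1) = d j) →
      ∀ l, IsDigit (n + 1) k t l ↔ ∃ j, (d j).val = l := by
    intro t d hd l
    exact exists_congr fun i => by rw [hd]
  have hI : ∀ (t : ℕ) (d : Fin k → Fin (n + 1)), (∀ j, t / (n + 1) ^ j.val % (n + 1) = d j) →
      (TupleIndep k (familyWord n L ++ []) n L.length t ↔
        ∀ s ∈ L, ∃ i : Fin n, s i = true ∧ ∀ j, d j ≠ i.castSucc) := by
    intro t d hd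
    rw [List.forall_mem_iff_forall_getElem]
    refine forall_congr' fun j => forall_congr' fun hj => ?_
    rw [Fin.exists_iff]
    refine exists_congr fun i => ?_
    rw [← exists_prop]
    refine exists_congr fun hi => and_congr (entry_familyWord L [] hj ⟨i, hi⟩) ?_
    rw [hD t d hd]
    push Not
    exact forall_congr' fun j => by simp [Fin.ext_iff]
  refine mem_selection.trans ?_
  constructor
  · rintro ⟨t, ht, hu, hul⟩
    let d : Fin k → Fin (n + 1) := fun i => ⟨t / (n + 1) ^ i.val % (n + 1),
      Nat.mod_lt _ (by omega)⟩
    exact ⟨d, (hI t d fun _ => rfl).1 hu, fun l => (hul l).trans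
      (or_congr_right (hD t d (fun _ => rfl) l))⟩
  · rintro ⟨d, hd, hul⟩
    obtain ⟨t, ht, htd⟩ := exists_digits d
    exact ⟨t, ht, (hI t d htd).2 hd, fun l => (hul l).trans (or_congr_right (hD t d htd l).symm)⟩

open scoped Classical in
/-- The letters after the last separator, except for the last two letters of the word. -/
noncomputable def trimmedSuffix (w : Word) : Word :=
  (List.range (w.length - 2)).flatMap fun q =>
    if ∀ r < w.length, q ≤ r → letterAt w r ≠ 2 then [Fin.ofNat 3 (letterAt w q)] else []

theorem genWord_trimmedSuffix : GenWord (fun w (_ : Unit) => trimmedSuffix w) :=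
  .flatMap_range (.sub .length (.const 2)) (.ite (.forall_lt .length (.imp (.le (.weaken .var) .var)
    (.not (.eq (.letterAt .var) (.const 2))))) (.letter (.letterAt (.weaken .var))))

/-- The code of a family ends with a separator and a solution contains none, so the last separator
marks where the solution begins; the two letters of `x` are the additional entries. -/
theorem trimmedSuffix_append (u v x : Word) (hv : ∀ a ∈ v ++ x, a ≠ 2) (hx : x.length = 2) :
    trimmedSuffix (u ++ [2] ++ (v ++ x)) = v := by
  classical
  set w := u ++ [2] ++ (v ++ x) with hw
  have hlen : w.length - 2 = (u.length + 1) + v.length := by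
    simp [hw, hx]
    omega
  have hu : (u ++ [2]).length = u.length + 1 := by simp
  have hlast : ∀ i, letterAt w (u.length + 1 + i) = letterAt (v ++ x) i := by
    intro i
    rw [← hu, hw, letterAt_append_right]
  have h2 : ∀ r, u.length + 1 ≤ r → letterAt w r ≠ 2 := by
    intro r hr
    obtain ⟨i, rfl⟩ := Nat.exists_eq_add_of_le hr
    rw [hlast, letterAt]
    rcases lt_or_ge i (v ++ x).length with hi | hi
    · rw [List.getD_eq_getElem _ _ hi]
      intro h
      exact hv _ (List.getElem_mem hi) (Fin.ext h)
    · rw [List.getD_eq_default _ _ hi]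
      simp
  rw [trimmedSuffix, hlen, List.range_add, List.flatMap_append, List.flatMap_eq_nil_iff.2,
    List.nil_append, List.flatMap_map]
  · rw [List.flatMap_congr (g := fun i => [v.getD i 0]), ← List.map_eq_flatMap]
    · refine List.ext_getElem (by simp) fun i h1 h2 => ?_
      rw [List.getElem_map, List.getElem_range, List.getD_eq_getElem _ _ h2]
    · intro i hi
      rw [if_pos fun r _ hr => h2 r (by omega), hlast, letterAt,
        List.getD_append _ _ _ _ (List.mem_range.1 hi)]
      simp
  · intro q hq
    have hq := List.mem_range.1 hq
    refine if_neg fun h => h u.length (by simp [hw]) (by omega) ?_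
    rw [hw, letterAt, List.getD_append _ _ _ _ (by simp), List.getD_append_right _ _ _ _ le_rfl]
    simp

theorem exists_familyWord_eq_append (n : ℕ) (L : List (Fin n → Bool)) :
    ∃ u, familyWord n L = u ++ [2] := by
  rcases L.eq_nil_or_concat with rfl | ⟨L, v, rfl⟩
  · exact ⟨List.replicate n 1, by simp [familyWord]⟩
  · exact ⟨List.replicate n 1 ++ [2] ++ L.flatMap (fun v => vectorWord v ++ [2]) ++ vectorWord v,
      by simp [familyWord]⟩

theorem getElem_vectorWord {n i : ℕ} (v : Fin n → Bool) (hi : i < (vectorWord v).length) :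
    (vectorWord v)[i] = if v ⟨i, by rwa [length_vectorWord] at hi⟩ then 1 else 0 := by
  simp [vectorWord]

theorem vectorWord_extend {n : ℕ} (T : Fin n → Bool) :
    vectorWord (extend T) = vectorWord T ++ [1, 0] := by
  refine List.ext_getElem (by simp [length_vectorWord]) fun i h1 h2 => ?_
  rw [getElem_vectorWord]
  rw [length_vectorWord] at h1
  rcases lt_or_ge i n with hi | hi
  · rw [List.getElem_append_left (by rwa [length_vectorWord])]
    simp [getElem_vectorWord, extend, hi]
  · rw [List.getElem_append_right (by rwa [length_vectorWord])]
    simp only [length_vectorWord]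
    obtain rfl | rfl : i = n ∨ i = n + 1 := by omega
    · simp [extend]
    · simp [extend]

theorem ne_two_of_mem_vectorWord {n : ℕ} {T : Fin n → Bool} : ∀ a ∈ vectorWord T, a ≠ 2 := by
  intro a ha
  obtain ⟨i, rfl⟩ := (List.mem_ofFn' _ _).1 ha
  change (if T i = true then (1 : Letter) else 0) ≠ 2
  split_ifs <;> decide

theorem trimmedSuffix_familyWord {n : ℕ} (L : List (Fin n → Bool)) (T : Fin n → Bool) :
    trimmedSuffix (familyWord n L ++ vectorWord (extend T)) = vectorWord T := by
  obtain ⟨u, hu⟩ := exists_familyWord_eq_append n L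
  rw [hu, vectorWord_extend]
  refine trimmedSuffix_append _ _ _ ?_ rfl
  rw [← vectorWord_extend]
  exact ne_two_of_mem_vectorWord

theorem kMaxIndSet_reducible_closureMax {k : ℕ} (hk : 2 ≤ k) :
    PolyDelayReducible (enumKMaxIndSet k) (enumClosureMax (S10 k)) := by
  -- The auxiliary problem has exactly one solution for every word: it removes the hypergraph and
  -- the two additional entries.
  refine ⟨tupleFamily k, fun w => {y | y ∈ [trimmedSuffix w]}, polyTime_tupleFamily k,
    .of_gen (fun _ => List.nodup_singleton _) (GenList.singleton genWord_trimmedSuffix),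
    fun x => ?_⟩
  by_cases hx : ∃ (n : ℕ) (L : List (Fin n → Bool)), x = familyWord n L
  · obtain ⟨n, L, rfl⟩ := hx
    by_cases hL : ∀ s ∈ L, (support s).card ≤ k
    · obtain ⟨V, hV, hS⟩ := tupleFamily_familyWord hL
      have hB : ∀ y, y ∈ enumClosureMax (S10 k) (tupleFamily k (familyWord n L)) ↔
          ∃ T, Maximal (Indep {u | u ∈ L}) T ∧ y = vectorWord (extend T) := by
        intro y
        rw [hV, mem_enumClosureMax]
        simp only [hS.mem_maxElements hk hL]
        constructor
        · rintro ⟨_, ⟨T, hT, rfl⟩, rfl⟩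
          exact ⟨T, hT, rfl⟩
        · rintro ⟨T, hT, rfl⟩
          exact ⟨_, ⟨T, hT, rfl⟩, rfl⟩
      constructor
      · intro y hy z hz hne
        obtain ⟨T, -, rfl⟩ := (hB y).1 hy
        obtain ⟨U, -, rfl⟩ := (hB z).1 hz
        refine Set.eq_empty_of_forall_notMem fun u ⟨h, h'⟩ => hne ?_
        have h := List.mem_singleton.1 h
        have h' := List.mem_singleton.1 h'
        rw [trimmedSuffix_familyWord] at h h'
        rw [vectorWord_injective (h.symm.trans h')]
      · ext z
        rw [mem_enumKMaxIndSet, and_iff_right hL]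
        simp only [Set.mem_iUnion, exists_prop, hB]
        constructor
        · rintro ⟨T, hT, rfl⟩
          exact ⟨_, ⟨T, hT, rfl⟩, List.mem_singleton.2 (trimmedSuffix_familyWord L T).symm⟩
        · rintro ⟨_, ⟨T, hT, rfl⟩, h⟩
          exact ⟨T, hT, (List.mem_singleton.1 h).trans (trimmedSuffix_familyWord L T)⟩
    · have hE : enumKMaxIndSet k (familyWord n L) = ∅ :=
        Set.eq_empty_of_forall_notMem fun y hy => hL (mem_enumKMaxIndSet.1 hy).1
      rw [tupleFamily_familyWord_of_not hL, enumClosureMax_eq_empty nil_ne_familyWord, hE]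
      simp
  · push Not at hx
    have hf : tupleFamily k x = [] := onFamily_zero_eq_nil _ hx
    rw [hf, enumClosureMax_eq_empty nil_ne_familyWord, enumKMaxIndSet_eq_empty hx]
    simp

end SetClosure

theorem mainTheorem5 (k : ℕ) (hk : 2 ≤ k) :
    (∀ (n : ℕ) (S : Set (Fin n → Bool)),
      SetClosure.maxElements (SetClosure.Cl (SetClosure.S10 k) S) =
        SetClosure.maxElements (SetClosure.Cl (SetClosure.S12 k) S)) ∧
    EnumComplexity.Equivalent (SetClosure.enumClosureMax (SetClosure.S10 k))
      (SetClosure.enumKMaxIndSet k) :=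
  ⟨SetClosure.maxElements_Cl_S10_eq k, SetClosure.closureMax_reducible_kMaxIndSet hk,
    SetClosure.kMaxIndSet_reducible_closureMax hk⟩
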